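/- Let $d\ge 1$ be an integer, $1\le p<\infty$, and $q:=p/(p-1)$ ($q:=\infty$ if $p=1$). Let $w\in L^1_{\mathrm{loc}}(\mathbb R^d)$ with $w\ge 0$ a.e., and set $\mu(dx):=w\,dx$ and $\varphi:=w^{1/p}$. Assume: - (Reg) $\varphi^{-q}\in L^1_{\mathrm{loc}}(dx)$ if $p>1$, and $\varphi^{-1}\in L^\infty_{\mathrm{loc}}(dx)$ if $p=1$ (with $1/0:=+\infty$); - (Diff) $\varphi\in W^{1,p}_{\mathrm{loc}}(dx)$ and $\beta:=p\,\frac{\nabla\varphi}{\varphi}\in L^q_{\mathrm{loc}}(\mu;\mathbb R^d)$, where $\nabla\varphi$ is the weak gradient and $\beta:=0$ on $\{\varphi=0\}$; - if $p=1$, also $\nabla\varphi\in L^\infty_{\mathrm{loc}}(dx;\mathbb R^d)$. Consider the following spaces. - $H^{1,p}(\mu)$ is the abstract completion of $X:=\{u\in C^\infty(\mathbb R^d): \|u\|_{1,p,\mu}<\infty\}$ with respect to the pre-norm $\|u\|_{1,p,\mu}:=\big(\|\nabla u\|_{L^p(\mu;\mathbb R^d)}^p+\|u\|_{L^p(\mu)}^p\big)^{1/p}$.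 The map $u\mapsto (u,\nabla u)$ extends continuously to $H^{1,p}(\mu)$; its two components are the canonical map $H^{1,p}(\mu)\to L^p(\mu)$ and the gradient $H^{1,p}(\mu)\to L^p(\mu;\mathbb R^d)$. - $V^{1,p}(\mu)$ is the set of all $f\in L^p(\mu)$ for which there is a gradient $\nabla^\mu f=(\partial^\mu_1f,\dots,\partial^\mu_df)\in L^p(\mu;\mathbb R^d)$ with $$\int \partial^\mu_i f\,\eta\,d\mu=-\int f\,\partial_i\eta\,d\mu-\int f\,\eta\,\beta_i\,d\mu\qquad\text{for all }\eta\in C_0^\infty(\mathbb R^d),\ 1\le i\le d.$$ - $W^{1,p}(\mu)$ is the set of all $f\in L^p(\mu)$ (which, by (Reg), lie in $L^1_{\mathrm{loc}}(dx)$) whose distributional gradient $\mathrm Df$ is (represented by a function) in $L^p(\mu;\mathbb R^d)$. Then $$H^{1,p}(\mu)=V^{1,p}(\mu)=W^{1,p}(\mu).$$ More precisely: the canonical map $H^{1,p}(\mu)\to L^p(\mu)$ is injective, so that $H^{1,p}(\mu)$ is a space of $\mu$-classes of functions; (the classes of) the functions in $C_0^\infty(\mathbb R^d)$ are dense in $H^{1,p}(\mu)$,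 so that $H^{1,p}(\mu)$ is also the completion of $C_0^\infty(\mathbb R^d)$; the image of this map is $V^{1,p}(\mu)$, and $V^{1,p}(\mu)=W^{1,p}(\mu)$ as subsets of $L^p(\mu)$; and the gradients of the three spaces are unique and coincide $\mu$-a.e., hence so do their norms $\big(\|\text{gradient}\|_{L^p(\mu;\mathbb R^d)}^p+\|f\|_{L^p(\mu)}^p\big)^{1/p}$. -/

import Mathlib

open MeasureTheory Set
open scoped ENNReal ContDiff

noncomputable section

namespace WeightedSobolev

/-- `ℝ^d` with the Euclidean norm. -/
abbrev E (d : ℕ) : Type := EuclideanSpace ℝ (Fin d)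

/-- The measure `μ(dx) = w dx`. -/
def weightMeasure {d : ℕ} (w : E d → ℝ) : Measure (E d) :=
  volume.withDensity fun x => ENNReal.ofReal (w x)

/-- `φ = w^{1/p}`. -/
def phi {d : ℕ} (p : ℝ≥0∞) (w : E d → ℝ) (x : E d) : ℝ :=
  w x ^ (1 / p.toReal)

/-- The conjugate exponent `q = p / (p - 1)`, equal to `∞` for `p = 1`. -/
def conjExp (p : ℝ≥0∞) : ℝ≥0∞ := p / (p - 1)

/-- `f ∈ L^r_loc(ν)`. -/
def LocMemLp {d : ℕ} {F : Type*} [NormedAddCommGroup F]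
    (f : E d → F) (r : ℝ≥0∞) (ν : Measure (E d)) : Prop :=
  ∀ K : Set (E d), IsCompact K → MemLp f r (ν.restrict K)

/-- `η ∈ C_0^∞(ℝ^d)`: smooth with compact support. -/
def IsTestFunction {d : ℕ} (η : E d → ℝ) : Prop :=
  ContDiff ℝ ∞ η ∧ HasCompactSupport η

/-- The distributional gradient of `u ∈ L^1_loc(dx)` is the function `G ∈ L^1_loc(dx; ℝ^d)`. -/
def HasWeakGradient {d : ℕ} (u : E d → ℝ) (G : E d → E d) : Prop :=
  LocallyIntegrable u volume ∧ LocallyIntegrable G volume ∧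
    ∀ η : E d → ℝ, IsTestFunction η → ∀ i : Fin d,
      ∫ x, u x * (gradient η x) i = - ∫ x, (G x) i * η x

/-- Condition (Reg): `φ^{-q} ∈ L^1_loc(dx)` if `p > 1`, and `φ^{-1} ∈ L^∞_loc(dx)` if `p = 1`.
The powers are taken in `[0, ∞]`, so that they are `+∞` where `φ = 0`. -/
def Reg {d : ℕ} (p : ℝ≥0∞) (w : E d → ℝ) : Prop :=
  (p ≠ 1 → ∀ K : Set (E d), IsCompact K →
    ∫⁻ x in K, ENNReal.ofReal (phi p w x) ^ (-(conjExp p).toReal) < ⊤) ∧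
  (p = 1 → ∀ K : Set (E d), IsCompact K →
    essSup (fun x => (ENNReal.ofReal (phi p w x))⁻¹) (volume.restrict K) < ⊤)

/-- The logarithmic derivative `β = p ∇φ / φ`, for a version `G` of `∇φ`;
it is `0` where `φ = 0`. -/
def logDeriv {d : ℕ} (p : ℝ≥0∞) (w : E d → ℝ) (G : E d → E d) (x : E d) : E d :=
  (p.toReal * (phi p w x)⁻¹) • G x

/-- Condition (Diff), for a version `G` of the weak gradient `∇φ`:
`φ ∈ W^{1,p}_loc(dx)` and `β ∈ L^q_loc(μ; ℝ^d)`. -/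
def Diff {d : ℕ} (p : ℝ≥0∞) (w : E d → ℝ) (G : E d → E d) : Prop :=
  LocMemLp (phi p w) p volume ∧ LocMemLp G p volume ∧ HasWeakGradient (phi p w) G ∧
    LocMemLp (logDeriv p w G) (conjExp p) (weightMeasure w)

/-! ### The space `V^{1,p}(μ)` -/

/-- `v ∈ L^p(μ; ℝ^d)` is the gradient of `f ∈ L^p(μ)` in the sense of the integration by parts
formula with the logarithmic derivative `β`. -/
def IsGradV {d : ℕ} (p : ℝ≥0∞) (w : E d → ℝ) (G : E d → E d)
    (f : Lp ℝ p (weightMeasure w)) (v : Lp (E d) p (weightMeasure w)) : Prop :=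
  ∀ η : E d → ℝ, IsTestFunction η → ∀ i : Fin d,
    ∫ x, (v x) i * η x ∂(weightMeasure w) =
      - (∫ x, f x * (gradient η x) i ∂(weightMeasure w))
      - ∫ x, f x * η x * (logDeriv p w G x) i ∂(weightMeasure w)

/-- `V^{1,p}(μ)`, as a set of `μ`-classes. -/
def V {d : ℕ} (p : ℝ≥0∞) (w : E d → ℝ) (G : E d → E d) :
    Set (Lp ℝ p (weightMeasure w)) :=
  {f | ∃ v, IsGradV p w G f v}

/-! ### The Kufner-Sobolev space `W^{1,p}(μ)` -/

/-- `v ∈ L^p(μ; ℝ^d)` is the distributional gradient of `f ∈ L^p(μ)`. -/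
def IsGradW {d : ℕ} (p : ℝ≥0∞) (w : E d → ℝ)
    (f : Lp ℝ p (weightMeasure w)) (v : Lp (E d) p (weightMeasure w)) : Prop :=
  HasWeakGradient (fun x => f x) (fun x => v x)

/-- `W^{1,p}(μ)`, as a set of `μ`-classes. -/
def W {d : ℕ} (p : ℝ≥0∞) (w : E d → ℝ) : Set (Lp ℝ p (weightMeasure w)) :=
  {f | ∃ v, IsGradW p w f v}

/-! ### The space `H^{1,p}(μ)` -/

theorem gradient_add' {d : ℕ} {u v : E d → ℝ} (hu : ContDiff ℝ ∞ u) (hv : ContDiff ℝ ∞ v) :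
    gradient (u + v) = gradient u + gradient v := by
  funext x
  have h1 := (hu.differentiable (by simp)) x
  have h2 := (hv.differentiable (by simp)) x
  simp only [gradient, Pi.add_apply]
  rw [fderiv_add h1 h2, map_add]

theorem gradient_smul' {d : ℕ} (c : ℝ) {u : E d → ℝ} (hu : ContDiff ℝ ∞ u) :
    gradient (c • u) = c • gradient u := by
  funext x
  have h1 := (hu.differentiable (by simp)) x
  simp only [gradient, Pi.smul_apply]
  rw [fderiv_const_smul h1 c, map_smulₛₗ]
  simp

/-- The vector space `X` of all `u ∈ C^∞(ℝ^d)` with `‖u‖_{1,p,μ} < ⊤`. -/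
def smoothSubmodule {d : ℕ} (p : ℝ≥0∞) (μ : Measure (E d)) : Submodule ℝ (E d → ℝ) where
  carrier := {u | ContDiff ℝ ∞ u ∧ MemLp u p μ ∧ MemLp (gradient u) p μ}
  zero_mem' := by
    have h : gradient (0 : E d → ℝ) = 0 := by
      funext x; simp [gradient]
    refine ⟨contDiff_const, MemLp.zero, ?_⟩
    rw [h]; exact MemLp.zero
  add_mem' := by
    rintro u v ⟨hu, hu1, hu2⟩ ⟨hv, hv1, hv2⟩
    refine ⟨hu.add hv, hu1.add hv1, ?_⟩
    rw [gradient_add' hu hv]; exact hu2.add hv2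
  smul_mem' := by
    rintro c u ⟨hu, hu1, hu2⟩
    refine ⟨contDiff_const.smul hu, hu1.const_smul c, ?_⟩
    rw [gradient_smul' c hu]; exact hu2.const_smul c

/-- `X` as a type of its own, so that it carries no topology but that of `‖·‖_{1,p,μ}`. -/
def X {d : ℕ} (p : ℝ≥0∞) (μ : Measure (E d)) : Type := smoothSubmodule p μ

instance {d : ℕ} (p : ℝ≥0∞) (μ : Measure (E d)) : AddCommGroup (X p μ) :=
  inferInstanceAs (AddCommGroup (smoothSubmodule p μ))

instance {d : ℕ} (p : ℝ≥0∞) (μ : Measure (E d)) : Module ℝ (X p μ) :=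
  inferInstanceAs (Module ℝ (smoothSubmodule p μ))

/-- The function underlying an element of `X`. -/
def X.toFun {d : ℕ} {p : ℝ≥0∞} {μ : Measure (E d)} (u : X p μ) : E d → ℝ := u.1

/-- `L^p(μ) × L^p(μ; ℝ^d)` with the norm `(‖f‖^p + ‖v‖^p)^{1/p}`. -/
abbrev Pair {d : ℕ} (p : ℝ≥0∞) (μ : Measure (E d)) [Fact (1 ≤ p)] : Type :=
  WithLp p (Lp ℝ p μ × Lp (E d) p μ)

/-- The linear map `u ↦ (u, ∇u)` on `X`. -/
def X.pair {d : ℕ} (p : ℝ≥0∞) (μ : Measure (E d)) [Fact (1 ≤ p)] : X p μ →ₗ[ℝ] Pair p μ where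
  toFun u := WithLp.toLp p (u.2.2.1.toLp u.1, u.2.2.2.toLp (gradient u.1))
  map_add' u v := by
    have h : gradient (u + v : X p μ).1 = gradient u.1 + gradient v.1 :=
      gradient_add' u.2.1 v.2.1
    rw [← WithLp.toLp_add, Prod.mk_add_mk, ← MemLp.toLp_add, ← MemLp.toLp_add]
    congr 2
    exact MemLp.toLp_congr _ _ (by rw [h])
  map_smul' c u := by
    have h : gradient (c • u : X p μ).1 = c • gradient u.1 := gradient_smul' c u.2.1
    rw [RingHom.id_apply, ← WithLp.toLp_smul, Prod.smul_mk, ← MemLp.toLp_const_smul,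
      ← MemLp.toLp_const_smul]
    congr 2
    exact MemLp.toLp_congr _ _ (by rw [h])

/-- The pre-norm `‖u‖_{1,p,μ} = (‖∇u‖_{L^p(μ)}^p + ‖u‖_{L^p(μ)}^p)^{1/p}` on `X`. -/
instance {d : ℕ} (p : ℝ≥0∞) (μ : Measure (E d)) [Fact (1 ≤ p)] :
    SeminormedAddCommGroup (X p μ) :=
  SeminormedAddCommGroup.induced (X p μ) (Pair p μ) (X.pair p μ)

/-- `H^{1,p}(μ)`: the abstract completion of `X` with respect to `‖·‖_{1,p,μ}`. -/
abbrev H {d : ℕ} (p : ℝ≥0∞) (μ : Measure (E d)) [Fact (1 ≤ p)] : Type :=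
  UniformSpace.Completion (X p μ)

/-- The continuous extension to `H^{1,p}(μ)` of the isometry `u ↦ (u, ∇u)`. -/
def H.pair {d : ℕ} {p : ℝ≥0∞} {μ : Measure (E d)} [Fact (1 ≤ p)] (h : H p μ) : Pair p μ :=
  UniformSpace.Completion.extension (X.pair p μ) h

/-- The canonical map `H^{1,p}(μ) → L^p(μ)`. -/
def H.toLp {d : ℕ} {p : ℝ≥0∞} {μ : Measure (E d)} [Fact (1 ≤ p)] (h : H p μ) : Lp ℝ p μ :=
  (H.pair h).fst

/-- The gradient `H^{1,p}(μ) → L^p(μ; ℝ^d)`. -/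
def H.grad {d : ℕ} {p : ℝ≥0∞} {μ : Measure (E d)} [Fact (1 ≤ p)] (h : H p μ) :
    Lp (E d) p μ :=
  (H.pair h).snd

end WeightedSobolev

end

/-!
# Weighted Sobolev spaces with weakly differentiable weights

Condition (Reg) and Hölder's inequality embed `L^p(μ)` continuously into `L^1_loc(dx)`, so the graph
of the distributional gradient is closed in `L^p(μ) × L^p(μ; ℝ^d)`. The canonical map from the
completion into this product is an isometry with values in that graph; this gives injectivity. What
remains is to show that `V = W` with the same gradients, and that every element of `W` is a limit of
test functions.

**`V = W`.** The formula defining `V` says exactly that `w f` has the weak gradient `w v + f (w β)`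
with respect to Lebesgue measure (`IsRegularWeight.isGradV_iff`). The weight `w = φ^p` is weakly
differentiable with gradient `w β`, so the inclusion of `W` in `V` is the product rule
(`HasWeakGradient.mul`). Conversely, the chain rule is applied to `T(w f (φ² + ε²)^{-p/2})`, where
`T` is bounded and so is `t ↦ t T'(t)`. The terms containing `∇φ` cancel up to an error dominated by
a multiple of `φ⁻¹ |∇φ|`, and this function is locally integrable, again by (Reg) and Hölder's
inequality. Hence `T(f)` has the weak gradient `T'(f) v`
(`IsRegularWeight.hasWeakGradient_arctanTrunc`), and `T` can be let tend to the identity.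

**Density.** Truncation and cut-off reduce to a bounded `f` with compact support. Let `ρ_n` be a
mollifier. In general `∇(ρ_n ⋆ f) = ρ_n ⋆ ∇f` converges to `∇f` only almost everywhere and in
`L^1(dx)`, whereas convergence of `φ ∇(ρ_n ⋆ f)` in `L^p(dx)` is wanted. By Vitali's theorem it
suffices that these functions are uniformly integrable in `L^p(dx)`. As in the commutator lemma of
DiPerna and Lions,
`φ(x) ∇(ρ_n ⋆ f)(x) = (ρ_n ⋆ ∇(f φ))(x) + ∫ f(x - z) (φ(x) - φ(x - z)) ∇ρ_n(z) dz`.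
Since `f` is bounded, `∇(f φ) = φ ∇f + f ∇φ` lies in `L^p(dx)`. In the last term the singularity of
`∇ρ_n` is compensated by the difference of `φ`, because `∫ |∇ρ_n(z)| |z| dz` is bounded, and the
difference quotients of `φ` are controlled by averages of translates of `|∇φ|`
(`HasWeakGradient.smallOn_sub`). Uniform integrability is expressed by the predicate `SmallOn`, a
bound on the integrals over all sets of given volume. Translations preserve it, and so do averages.
This argument treats all `1 ≤ p < ∞` alike.
-/

namespace WeightedSobolev

open Filter Topology
open scoped Convolution

/-! ### Averages of families of functions in `L^p` -/

section Averaging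

/-- Jensen's inequality for the `p`-th power, for a finite measure. -/
theorem rpow_lintegral_le {β : Type*} [MeasurableSpace β] (ν : Measure β) {p : ℝ} (hp : 1 ≤ p)
    {g : β → ℝ≥0∞} (hg : AEMeasurable g ν) :
    (∫⁻ s, g s ∂ν) ^ p ≤ ν univ ^ (p - 1) * ∫⁻ s, g s ^ p ∂ν := by
  rcases hp.eq_or_lt with rfl | hp1
  · simp
  have hc : p.HolderConjugate (p.conjExponent) := Real.HolderConjugate.conjExponent hp1
  have h := ENNReal.lintegral_mul_le_Lp_mul_Lq ν hc hg (aemeasurable_const (b := (1 : ℝ≥0∞)))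
  simp only [Pi.mul_apply, mul_one, ENNReal.one_rpow, lintegral_const, one_mul] at h
  have hp0 : 0 < p := by linarith
  calc (∫⁻ s, g s ∂ν) ^ p
      ≤ ((∫⁻ s, g s ^ p ∂ν) ^ (1 / p) * ν univ ^ (1 / p.conjExponent)) ^ p :=
        ENNReal.rpow_le_rpow h hp0.le
    _ = ν univ ^ (p - 1) * ∫⁻ s, g s ^ p ∂ν := by
        rw [ENNReal.mul_rpow_of_nonneg _ _ hp0.le, ← ENNReal.rpow_mul, ← ENNReal.rpow_mul,
          one_div_mul_cancel hp0.ne', ENNReal.rpow_one, mul_comm]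
        congr 2
        have := hc.symm.sub_one_mul_conj
        simp only [Real.conjExponent]
        field_simp

/-- Minkowski's integral inequality in the form used below: an integral superposition of functions
whose `p`-th powers have integral at most `C`. -/
theorem lintegral_rpow_lintegral_le {α β : Type*} [MeasurableSpace α] [MeasurableSpace β]
    (m : Measure α) [SFinite m] (ν : Measure β) [SFinite ν] {p : ℝ} (hp : 1 ≤ p)
    {h : α → β → ℝ≥0∞} (hm : Measurable (Function.uncurry h)) {C : ℝ≥0∞}
    (hC : ∀ s, ∫⁻ x, h x s ^ p ∂m ≤ C) :
    ∫⁻ x, (∫⁻ s, h x s ∂ν) ^ p ∂m ≤ ν univ ^ p * C := by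
  calc ∫⁻ x, (∫⁻ s, h x s ∂ν) ^ p ∂m
      ≤ ∫⁻ x, ν univ ^ (p - 1) * ∫⁻ s, h x s ^ p ∂ν ∂m :=
        lintegral_mono fun x => rpow_lintegral_le ν hp (hm.of_uncurry_left).aemeasurable
    _ = ν univ ^ (p - 1) * ∫⁻ x, ∫⁻ s, h x s ^ p ∂ν ∂m :=
        lintegral_const_mul _ (Measurable.lintegral_prod_right'
          (f := fun z : α × β => h z.1 z.2 ^ p) (hm.pow_const p))
    _ = ν univ ^ (p - 1) * ∫⁻ s, ∫⁻ x, h x s ^ p ∂m ∂ν := by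
        rw [lintegral_lintegral_swap]
        exact (hm.pow_const p).aemeasurable
    _ ≤ ν univ ^ (p - 1) * ∫⁻ _, C ∂ν := by
        gcongr with s
        exact hC s
    _ = ν univ ^ p * C := by
        rw [lintegral_const, mul_comm C, ← mul_assoc]
        congr 1
        conv_lhs => rw [← ENNReal.rpow_one (ν univ), ← ENNReal.rpow_mul, one_mul]
        rw [← ENNReal.rpow_add_of_nonneg _ _ (by linarith) zero_le_one, sub_add_cancel]

/-- The `p`-th power of `g` has integral at most `C` over every set of volume at most `δ`. This
property is stable under translations and averages of translates, which is how uniform integrability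
of mollifications is obtained. -/
def SmallOn {d : ℕ} (p : ℝ) (δ C : ℝ≥0∞) (g : E d → ℝ≥0∞) : Prop :=
  ∀ A : Set (E d), MeasurableSet A → volume A ≤ δ → ∫⁻ x in A, g x ^ p ≤ C

variable {d : ℕ} {p : ℝ} {δ C : ℝ≥0∞} {g : E d → ℝ≥0∞}

theorem SmallOn.mono {g' : E d → ℝ≥0∞} (hp : 0 ≤ p) (h : SmallOn p δ C g)
    (hg : ∀ x, g' x ≤ g x) : SmallOn p δ C g' := fun A hA hδ =>
  (lintegral_mono fun x => ENNReal.rpow_le_rpow (hg x) hp).trans (h A hA hδ)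

theorem SmallOn.translate (h : SmallOn p δ C g) (z : E d) :
    SmallOn p δ C fun x => g (x - z) := by
  intro A hA hδ
  have hA' : MeasurableSet ((fun x => x + z) ⁻¹' A) := measurable_add_const z hA
  have h1 := (measurePreserving_sub_right (volume : Measure (E d)) z).setLIntegral_comp_preimage_emb
    (MeasurableEquiv.subRight z).measurableEmbedding (fun x => g x ^ p) ((fun x => x + z) ⁻¹' A)
  have h2 : (fun x => x - z) ⁻¹' ((fun x => x + z) ⁻¹' A) = A := by
    ext x; simp
  rw [h2] at h1
  rw [h1]
  apply h _ hA'
  rwa [measure_preimage_add_right]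

theorem SmallOn.lintegral {β : Type*} [MeasurableSpace β] (ν : Measure β) [SFinite ν] (hp : 1 ≤ p)
    {h : E d → β → ℝ≥0∞} (hm : Measurable (Function.uncurry h))
    (hC : ∀ s, SmallOn p δ C fun x => h x s) :
    SmallOn p δ (ν univ ^ p * C) fun x => ∫⁻ s, h x s ∂ν := fun A hA hδ =>
  lintegral_rpow_lintegral_le _ ν hp hm fun s => hC s A hA hδ

theorem SmallOn.const_mul (hp : 0 ≤ p) (h : SmallOn p δ C g) (a : ℝ≥0∞) (hg : Measurable g) :
    SmallOn p δ (a ^ p * C) fun x => a * g x := by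
  intro A hA hδ
  simp_rw [ENNReal.mul_rpow_of_nonneg _ _ hp]
  rw [lintegral_const_mul _ (hg.pow_const p)]
  gcongr
  exact h A hA hδ

/-- Every function in `L^p` has small integrals over small sets. -/
theorem exists_smallOn {F : Type*} [NormedAddCommGroup F] {p : ℝ≥0∞} (hp : 1 ≤ p) (hp' : p ≠ ⊤)
    {f : E d → F} (hf : MemLp f p volume) {ε : ℝ} (hε : 0 < ε) :
    ∃ δ > 0, SmallOn p.toReal (ENNReal.ofReal δ) (ENNReal.ofReal ε) fun x => ‖f x‖ₑ := by
  have hp0 : p ≠ 0 := (zero_lt_one.trans_le hp).ne'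
  have hpr : 0 < p.toReal := ENNReal.toReal_pos hp0 hp'
  obtain ⟨δ, hδ, h⟩ := hf.eLpNorm_indicator_le hp hp' (ε := ε ^ (1 / p.toReal))
    (Real.rpow_pos_of_pos hε _)
  refine ⟨δ, hδ, fun A hA hAδ => ?_⟩
  have h1 := h A hA hAδ
  rw [eLpNorm_indicator_eq_eLpNorm_restrict hA, eLpNorm_eq_lintegral_rpow_enorm_toReal hp0 hp',
    ← ENNReal.ofReal_rpow_of_pos hε] at h1
  exact (ENNReal.rpow_le_rpow_iff (by positivity)).1 h1

/-- Families that have small integrals over small sets are uniformly integrable. -/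
theorem unifIntegrable_of_smallOn {ι F : Type*} [NormedAddCommGroup F] {p : ℝ≥0∞} (hp : 1 ≤ p)
    (hp' : p ≠ ⊤) {f : ι → E d → F}
    (h : ∀ ε : ℝ, 0 < ε → ∃ δ > 0, ∀ n,
      SmallOn p.toReal (ENNReal.ofReal δ) (ENNReal.ofReal ε) fun x => ‖f n x‖ₑ) :
    UnifIntegrable f p volume := by
  have hp0 : p ≠ 0 := (zero_lt_one.trans_le hp).ne'
  have hpr : 0 < p.toReal := ENNReal.toReal_pos hp0 hp'
  intro ε hε
  obtain ⟨δ, hδ, h1⟩ := h (ε ^ p.toReal) (Real.rpow_pos_of_pos hε _)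
  refine ⟨δ, hδ, fun n A hA hAδ => ?_⟩
  have h2 := h1 n A hA hAδ
  rw [eLpNorm_indicator_eq_eLpNorm_restrict hA, eLpNorm_eq_lintegral_rpow_enorm_toReal hp0 hp']
  calc _ ≤ (ENNReal.ofReal (ε ^ p.toReal)) ^ (1 / p.toReal) :=
        ENNReal.rpow_le_rpow h2 (by positivity)
    _ = ENNReal.ofReal ε := by
        rw [ENNReal.ofReal_rpow_of_pos (by positivity), ← Real.rpow_mul hε.le,
          mul_one_div_cancel hpr.ne', Real.rpow_one]

end Averaging

/-- Dominated convergence in `L^p`. -/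
theorem tendsto_eLpNorm_of_dominated {α F : Type*} [MeasurableSpace α] [NormedAddCommGroup F]
    {μ : Measure α} {p : ℝ≥0∞} (hp0 : p ≠ 0) (hp' : p ≠ ⊤) {f : ℕ → α → F} {g : α → F} {b : α → ℝ}
    (hf : ∀ n, AEStronglyMeasurable (f n) μ) (hg : AEStronglyMeasurable g μ) (hb : MemLp b p μ)
    (hfb : ∀ n, ∀ᵐ x ∂μ, ‖f n x‖ ≤ b x)
    (hfg : ∀ᵐ x ∂μ, Tendsto (fun n => f n x) atTop (𝓝 (g x))) :
    Tendsto (fun n => eLpNorm (f n - g) p μ) atTop (𝓝 0) := by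
  have hpr : 0 < p.toReal := ENNReal.toReal_pos hp0 hp'
  have hgb : ∀ᵐ x ∂μ, ‖g x‖ ≤ b x := by
    filter_upwards [ae_all_iff.2 hfb, hfg] with x h1 h2
    exact le_of_tendsto h2.norm (Eventually.of_forall h1)
  have key : Tendsto (fun n => ∫⁻ x, ‖f n x - g x‖ₑ ^ p.toReal ∂μ) atTop (𝓝 (∫⁻ _, 0 ∂μ)) := by
    apply tendsto_lintegral_of_dominated_convergence' (fun x => ‖(2 * b x)‖ₑ ^ p.toReal)
    · exact fun n => ((hf n).sub hg).enorm.pow_const _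
    · intro n
      filter_upwards [hfb n, hgb] with x h1 h2
      apply ENNReal.rpow_le_rpow _ hpr.le
      rw [enorm_le_iff_norm_le, Real.norm_eq_abs]
      calc ‖f n x - g x‖ ≤ ‖f n x‖ + ‖g x‖ := norm_sub_le _ _
        _ ≤ 2 * b x := by linarith
        _ ≤ _ := le_abs_self _
    · have := (hb.const_mul 2).eLpNorm_lt_top
      rw [eLpNorm_eq_lintegral_rpow_enorm_toReal hp0 hp'] at this
      exact ((ENNReal.rpow_lt_top_iff_of_pos (by positivity)).1 this).ne
    · filter_upwards [hfg] with x hx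
      have h1 : Tendsto (fun n => ‖f n x - g x‖ₑ) atTop (𝓝 0) := by
        have := (hx.sub_const (g x)).enorm
        simpa using this
      simpa [hpr] using h1.ennrpow_const p.toReal
  rw [lintegral_zero] at key
  have h2 := key.ennrpow_const (1 / p.toReal)
  rw [ENNReal.zero_rpow_of_pos (by positivity)] at h2
  refine h2.congr fun n => ?_
  rw [eLpNorm_eq_lintegral_rpow_enorm_toReal hp0 hp']
  rfl

/-! ### Classical gradients -/

section Gradient

variable {d : ℕ}

theorem inner_gradient (u : E d → ℝ) (x e : E d) : inner ℝ (gradient u x) e = fderiv ℝ u x e := by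
  simp [gradient]

theorem gradient_coord (u : E d → ℝ) (x : E d) (i : Fin d) :
    (gradient u x) i = fderiv ℝ u x (EuclideanSpace.single i 1) := by
  rw [← inner_gradient, EuclideanSpace.inner_single_right]
  simp

theorem norm_gradient (u : E d → ℝ) (x : E d) : ‖gradient u x‖ = ‖fderiv ℝ u x‖ := by
  simp [gradient]

theorem gradient_mul {u v : E d → ℝ} {x : E d} (hu : DifferentiableAt ℝ u x)
    (hv : DifferentiableAt ℝ v x) :
    gradient (fun y => u y * v y) x = u x • gradient v x + v x • gradient u x := by
  simp only [gradient]
  rw [fderiv_fun_mul hu hv, map_add]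
  simp

theorem continuous_gradient {u : E d → ℝ} (hu : ContDiff ℝ ∞ u) : Continuous (gradient u) :=
  (InnerProductSpace.toDual ℝ (E d)).symm.continuous.comp (hu.continuous_fderiv (by simp))

theorem gradient_eq_zero_of_notMem_tsupport {u : E d → ℝ} {x : E d} (hx : x ∉ tsupport u) :
    gradient u x = 0 := by
  have : fderiv ℝ u x = 0 :=
    Function.notMem_support.1 fun h => hx (support_fderiv_subset ℝ h)
  simp [gradient, this]

theorem hasCompactSupport_gradient {u : E d → ℝ} (hu : HasCompactSupport u) :
    HasCompactSupport (gradient u) :=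
  HasCompactSupport.intro' hu (isClosed_tsupport u) fun _ hx =>
    gradient_eq_zero_of_notMem_tsupport hx

theorem IsTestFunction.mul_left {η χ : E d → ℝ} (hη : IsTestFunction η) (hχ : ContDiff ℝ ∞ χ) :
    IsTestFunction fun x => χ x * η x :=
  ⟨hχ.mul hη.1, hη.2.mul_left⟩

end Gradient

/-! ### Standard mollifiers and cut-off functions -/

section Bump

variable {d : ℕ}

/-- The smooth bump function that is `1` on the ball of radius `r` and `0` outside the ball of
radius `2 r`. These are rescalings of each other. -/
noncomputable def bump (d : ℕ) (r : ℝ) (hr : 0 < r) : ContDiffBump (0 : E d) where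
  rIn := r
  rOut := 2 * r
  rIn_pos := hr
  rIn_lt_rOut := by linarith

theorem bump_eq (r : ℝ) (hr : 0 < r) (x : E d) : bump d r hr x = bump d 1 one_pos (r⁻¹ • x) := by
  rw [ContDiffBump.apply, ContDiffBump.apply]
  simp [bump, hr.ne']

/-- The gradient of the bump function of radius `r` is at most `C / r`. -/
theorem exists_norm_gradient_bump_le (d : ℕ) : ∃ C : ℝ, 0 ≤ C ∧ ∀ (r : ℝ) (hr : 0 < r) (x : E d),
    ‖gradient (bump d r hr) x‖ ≤ C * r⁻¹ := by
  have h1 : ContDiff ℝ ∞ (bump d 1 one_pos : E d → ℝ) := ContDiffBump.contDiff _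
  obtain ⟨C, hC⟩ := (hasCompactSupport_gradient
    (bump d 1 one_pos).hasCompactSupport).exists_bound_of_continuous (continuous_gradient h1)
  refine ⟨C, (norm_nonneg _).trans (hC 0), fun r hr x => ?_⟩
  have h2 : (bump d r hr : E d → ℝ) = fun x => bump d 1 one_pos (r⁻¹ • x) :=
    funext fun x => bump_eq r hr x
  rw [norm_gradient, h2, fderiv_comp_smul, norm_smul, ← norm_gradient, mul_comm,
    Real.norm_of_nonneg (inv_nonneg.2 hr.le)]
  gcongr
  exact hC _

/-- The mollifier supported in the ball of radius `2 / (n + 1)`. -/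
noncomputable def moll (d n : ℕ) : E d → ℝ :=
  (bump d (1 / ((n : ℝ) + 1)) Nat.one_div_pos_of_nat).normed volume

theorem moll_contDiff (n : ℕ) : ContDiff ℝ ∞ (moll d n) := ContDiffBump.contDiff_normed _

theorem moll_nonneg (n : ℕ) (x : E d) : 0 ≤ moll d n x := ContDiffBump.nonneg_normed _ _

theorem moll_hasCompactSupport (n : ℕ) : HasCompactSupport (moll d n) :=
  ContDiffBump.hasCompactSupport_normed _

theorem moll_continuous (n : ℕ) : Continuous (moll d n) := (moll_contDiff n).continuous

theorem lintegral_moll (n : ℕ) : ∫⁻ x, ‖moll d n x‖ₑ = 1 := by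
  simp_rw [Real.enorm_of_nonneg (moll_nonneg n _)]
  have hi : Integrable (moll d n) := ContDiffBump.integrable_normed _
  rw [← ofReal_integral_eq_lintegral_ofReal hi (ae_of_all _ (moll_nonneg n))]
  simp [moll, ContDiffBump.integral_normed]

theorem moll_tsupport_subset (n : ℕ) : tsupport (moll d n) ⊆ Metric.closedBall 0 2 := by
  rw [moll, ContDiffBump.tsupport_normed_eq]
  apply Metric.closedBall_subset_closedBall
  simp only [bump]
  have : 1 / ((n : ℝ) + 1) ≤ 1 := by
    rw [div_le_one (by positivity)]; linarith [(n.cast_nonneg : (0 : ℝ) ≤ n)]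
  linarith

/-- The first moments of the gradients of the mollifiers are bounded. -/
theorem exists_lintegral_gradient_moll_le (d : ℕ) : ∃ K : ℝ≥0∞, K ≠ ⊤ ∧ ∀ n,
    ∫⁻ z : E d, ‖gradient (moll d n) z‖ₑ * ‖z‖ₑ ≤ K := by
  obtain ⟨C, hC0, hC⟩ := exists_norm_gradient_bump_le d
  refine ⟨ENNReal.ofReal (2 * C * 2 ^ d), ENNReal.ofReal_ne_top, fun n => ?_⟩
  set r : ℝ := 1 / ((n : ℝ) + 1) with hr
  have hr0 : 0 < r := Nat.one_div_pos_of_nat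
  set b := bump d r hr0 with hb
  have hρ : moll d n = (∫ x, b x)⁻¹ • (b : E d → ℝ) := by
    funext x
    simp [moll, ContDiffBump.normed_def, hb, hr, div_eq_inv_mul]
  have hv0 : 0 < volume.real (Metric.closedBall (0 : E d) r) :=
    ENNReal.toReal_pos (Metric.measure_closedBall_pos _ _ hr0).ne' measure_closedBall_lt_top.ne
  have hI : volume.real (Metric.closedBall (0 : E d) r) ≤ ∫ x, b x :=
    b.measure_closedBall_le_integral volume
  have hbound : ∀ z, ‖gradient (moll d n) z‖ₑ * ‖z‖ₑ ≤
      (Metric.closedBall (0 : E d) (2 * r)).indicator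
        (fun _ => ENNReal.ofReal ((volume.real (Metric.closedBall (0 : E d) r))⁻¹ * (2 * C)))
        z := by
    intro z
    by_cases hz : z ∈ Metric.closedBall (0 : E d) (2 * r)
    · rw [indicator_of_mem hz, ← ofReal_norm, ← ofReal_norm, ← ENNReal.ofReal_mul (norm_nonneg _)]
      apply ENNReal.ofReal_le_ofReal
      rw [hρ, gradient_smul' _ b.contDiff, Pi.smul_apply, norm_smul,
        Real.norm_of_nonneg (inv_nonneg.2 (hv0.le.trans hI)), mul_assoc]
      have hz' : ‖z‖ ≤ 2 * r := by simpa using hz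
      have : ‖gradient b z‖ * ‖z‖ ≤ C * r⁻¹ * (2 * r) := by
        gcongr
        exact hC r hr0 z
      calc (∫ x, b x)⁻¹ * (‖gradient b z‖ * ‖z‖)
          ≤ (volume.real (Metric.closedBall (0 : E d) r))⁻¹ * (C * r⁻¹ * (2 * r)) := by gcongr
        _ = _ := by field_simp
    · have : z ∉ tsupport (moll d n) := by
        rw [moll, ContDiffBump.tsupport_normed_eq]
        exact hz
      rw [gradient_eq_zero_of_notMem_tsupport this]
      simp
  refine (lintegral_mono hbound).trans ?_
  rw [lintegral_indicator measurableSet_closedBall, setLIntegral_const,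
    Measure.addHaar_closedBall_mul volume (0 : E d) (by norm_num : (0 : ℝ) ≤ 2) hr0.le,
    ← ENNReal.ofReal_toReal (measure_closedBall_lt_top (μ := volume) (x := (0 : E d)) (r := r)).ne,
    ← ENNReal.ofReal_mul (by positivity), ← ENNReal.ofReal_mul (by positivity)]
  apply ENNReal.ofReal_le_ofReal
  change _ * (_ * volume.real (Metric.closedBall (0 : E d) r)) ≤ _
  rw [finrank_euclideanSpace_fin]
  apply le_of_eq
  field_simp

theorem ae_tendsto_moll_convolution {F : Type*} [NormedAddCommGroup F] [NormedSpace ℝ F]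
    [CompleteSpace F] {g : E d → F} (hg : LocallyIntegrable g volume) :
    ∀ᵐ x, Tendsto (fun n => (moll d n ⋆[ContinuousLinearMap.lsmul ℝ ℝ, volume] g) x) atTop
      (𝓝 (g x)) := by
  apply ContDiffBump.ae_convolution_tendsto_right_of_locallyIntegrable
    (φ := fun n : ℕ => bump d (1 / ((n : ℝ) + 1)) Nat.one_div_pos_of_nat) (K := 2) _ _ hg
  · have := (tendsto_one_div_add_atTop_nhds_zero_nat (𝕜 := ℝ)).const_mul 2
    simpa [bump] using this
  · exact Eventually.of_forall fun n => le_rfl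

/-- The cut-off function that is `1` on the ball of radius `n + 1`. -/
noncomputable def cutoff (d n : ℕ) : E d → ℝ := bump d ((n : ℝ) + 1) n.cast_add_one_pos

theorem cutoff_isTestFunction (n : ℕ) : IsTestFunction (cutoff d n) :=
  ⟨ContDiffBump.contDiff _, ContDiffBump.hasCompactSupport _⟩

theorem cutoff_nonneg (n : ℕ) (x : E d) : 0 ≤ cutoff d n x := ContDiffBump.nonneg _

theorem cutoff_le_one (n : ℕ) (x : E d) : cutoff d n x ≤ 1 := ContDiffBump.le_one _

theorem cutoff_eventuallyEq_one {n : ℕ} {x : E d} (hx : ‖x‖ < (n : ℝ) + 1) :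
    cutoff d n =ᶠ[𝓝 x] 1 :=
  ContDiffBump.eventuallyEq_one_of_mem_ball _ (by simpa [bump] using hx)

theorem cutoff_eq_one {n : ℕ} {x : E d} (hx : ‖x‖ < (n : ℝ) + 1) : cutoff d n x = 1 :=
  (cutoff_eventuallyEq_one hx).self_of_nhds

theorem gradient_cutoff_eq_zero {n : ℕ} {x : E d} (hx : ‖x‖ < (n : ℝ) + 1) :
    gradient (cutoff d n) x = 0 := by
  rw [gradient, (cutoff_eventuallyEq_one hx).fderiv_eq]
  have : (1 : E d → ℝ) = fun _ => 1 := rfl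
  simp [this]

theorem exists_norm_gradient_cutoff_le (d : ℕ) : ∃ C : ℝ, 0 ≤ C ∧ ∀ (n : ℕ) (x : E d),
    ‖gradient (cutoff d n) x‖ ≤ C := by
  obtain ⟨C, hC0, hC⟩ := exists_norm_gradient_bump_le d
  refine ⟨C, hC0, fun n x => (hC _ n.cast_add_one_pos x).trans ?_⟩
  have : ((n : ℝ) + 1)⁻¹ ≤ 1 := inv_le_one_of_one_le₀ (by linarith [(n.cast_nonneg : (0 : ℝ) ≤ n)])
  nlinarith

end Bump

/-! ### Weak gradients -/

section WeakGradient

variable {d : ℕ} {u v : E d → ℝ} {U V : E d → E d}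

theorem integrable_smul_gradient (hu : LocallyIntegrable u volume) {η : E d → ℝ}
    (hη : IsTestFunction η) : Integrable fun x => u x • gradient η x :=
  hu.integrable_smul_right_of_hasCompactSupport (continuous_gradient hη.1)
    (hasCompactSupport_gradient hη.2)

theorem IsTestFunction.integrable_smul {F : Type*} [NormedAddCommGroup F] [NormedSpace ℝ F]
    {η : E d → ℝ} (hη : IsTestFunction η) {U : E d → F} {μ : Measure (E d)}
    (hU : LocallyIntegrable U μ) : Integrable (fun x => η x • U x) μ :=
  hU.integrable_smul_left_of_hasCompactSupport hη.1.continuous hη.2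

theorem integral_coord {μ : Measure (E d)} {f : E d → E d} (hf : Integrable f μ) (i : Fin d) :
    (∫ x, f x ∂μ) i = ∫ x, f x i ∂μ :=
  ((EuclideanSpace.proj i : E d →L[ℝ] ℝ).integral_comp_comm hf).symm

/-- The defining formula of the weak gradient, as an identity of vectors. -/
theorem hasWeakGradient_iff : HasWeakGradient u U ↔
    LocallyIntegrable u volume ∧ LocallyIntegrable U volume ∧
      ∀ η : E d → ℝ, IsTestFunction η → ∫ x, u x • gradient η x = - ∫ x, η x • U x := by
  refine and_congr_right fun hu => and_congr_right fun hU => forall_congr' fun η =>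
    forall_congr' fun hη => ?_
  have h1 := integrable_smul_gradient hu hη
  have h2 := hη.integrable_smul hU
  constructor
  · intro h
    ext i
    rw [integral_coord h1, PiLp.neg_apply, integral_coord h2]
    simpa [mul_comm] using h i
  · intro h i
    have := congrArg (fun z : E d => z i) h
    simp only [PiLp.neg_apply] at this
    rw [integral_coord h1, integral_coord h2] at this
    simpa [mul_comm] using this

theorem HasWeakGradient.integral_eq (h : HasWeakGradient u U) {η : E d → ℝ}
    (hη : IsTestFunction η) : ∫ x, u x • gradient η x = - ∫ x, η x • U x :=
  (hasWeakGradient_iff.1 h).2.2 η hη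

theorem HasWeakGradient.congr_ae (h : HasWeakGradient u U) (hu : u =ᵐ[volume] v)
    (hU : U =ᵐ[volume] V) : HasWeakGradient v V := by
  refine ⟨h.1.congr hu, h.2.1.congr hU, fun η hη i => ?_⟩
  have h1 : ∫ x, v x * (gradient η x) i = ∫ x, u x * (gradient η x) i :=
    integral_congr_ae (hu.mono fun x hx => by simp only [hx])
  have h2 : ∫ x, (V x) i * η x = ∫ x, (U x) i * η x :=
    integral_congr_ae (hU.mono fun x hx => by simp only [hx])
  rw [h1, h2, h.2.2 η hη i]

theorem HasWeakGradient.unique (h : HasWeakGradient u U) (h' : HasWeakGradient u V) :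
    U =ᵐ[volume] V := by
  apply ae_eq_of_integral_contDiff_smul_eq h.2.1 h'.2.1
  intro η hη hη'
  have h1 := h.integral_eq ⟨hη, hη'⟩
  rw [h'.integral_eq ⟨hη, hη'⟩] at h1
  exact (neg_injective h1).symm

/-- The classical gradient of a continuously differentiable function is its weak gradient. -/
theorem hasWeakGradient_gradient (hu : Differentiable ℝ u) (hu' : Continuous (gradient u)) :
    HasWeakGradient u (gradient u) := by
  refine ⟨hu.continuous.locallyIntegrable, hu'.locallyIntegrable, fun η hη i => ?_⟩
  have hη' := continuous_gradient hη.1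
  have h1 := (hη.integrable_smul (hu'.locallyIntegrable (μ := volume)))
  have h2 := integrable_smul_gradient (hu.continuous.locallyIntegrable (μ := volume)) hη
  have h3 := hη.integrable_smul (hu.continuous.locallyIntegrable (μ := volume))
  have h1' := (EuclideanSpace.proj i : E d →L[ℝ] ℝ).integrable_comp h1
  have h2' := (EuclideanSpace.proj i : E d →L[ℝ] ℝ).integrable_comp h2
  simp only [map_smul, smul_eq_mul, PiLp.proj_apply, gradient_coord] at h1' h2' h3
  simp only [gradient_coord]
  exact integral_mul_fderiv_eq_neg_fderiv_mul_of_integrable (by simpa only [mul_comm] using h1')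
    h2' (by simpa only [mul_comm] using h3) (fun x _ => hu x)
    (fun x _ => hη.1.differentiable (by simp) x)

theorem HasWeakGradient.smooth_mul (h : HasWeakGradient u U) {χ : E d → ℝ}
    (hχ : ContDiff ℝ ∞ χ) :
    HasWeakGradient (fun x => χ x * u x) (fun x => χ x • U x + u x • gradient χ x) := by
  refine hasWeakGradient_iff.2 ⟨?_, ?_, fun η hη => ?_⟩
  · exact h.1.continuous_smul hχ.continuous
  · exact (h.2.1.continuous_smul hχ.continuous).add (h.1.smul_continuous (continuous_gradient hχ))
  have h1 := h.integral_eq (hη.mul_left hχ)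
  have hg : ∀ x, gradient (fun x => χ x * η x) x = χ x • gradient η x + η x • gradient χ x :=
    fun x => gradient_mul (hχ.differentiable (by simp) x) (hη.1.differentiable (by simp) x)
  have i1 : Integrable fun x => (χ x * u x) • gradient η x :=
    integrable_smul_gradient (h.1.continuous_smul hχ.continuous) hη
  have i2 : Integrable fun x => η x • (u x • gradient χ x) :=
    hη.integrable_smul (h.1.smul_continuous (continuous_gradient hχ))
  have i3 : Integrable fun x => η x • (χ x • U x) :=
    hη.integrable_smul (h.2.1.continuous_smul hχ.continuous)
  have e1 : (fun x => u x • gradient (fun x => χ x * η x) x) =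
      fun x => (χ x * u x) • gradient η x + η x • (u x • gradient χ x) := by
    funext x
    rw [hg, smul_add, smul_smul, smul_comm (u x) (η x), mul_comm]
  have e2 : (fun x => (χ x * η x) • U x) = fun x => η x • (χ x • U x) := by
    funext x; rw [smul_smul, mul_comm]
  rw [e1, e2, integral_add i1 i2] at h1
  simp_rw [smul_add]
  rw [integral_add i3 i2, eq_sub_of_add_eq h1]
  abel

/-- Weak gradients pass to dominated almost everywhere limits. -/
theorem hasWeakGradient_of_tendsto {u' : ℕ → E d → ℝ} {U' : ℕ → E d → E d} {b B : E d → ℝ}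
    (h : ∀ n, HasWeakGradient (u' n) (U' n)) (hb : LocallyIntegrable b volume)
    (hB : LocallyIntegrable B volume) (hub : ∀ n, ∀ᵐ x, ‖u' n x‖ ≤ b x)
    (hUB : ∀ n, ∀ᵐ x, ‖U' n x‖ ≤ B x)
    (hu : ∀ᵐ x, Tendsto (fun n => u' n x) atTop (𝓝 (u x)))
    (hU : ∀ᵐ x, Tendsto (fun n => U' n x) atTop (𝓝 (U x))) : HasWeakGradient u U := by
  have hum : AEStronglyMeasurable u volume :=
    aestronglyMeasurable_of_tendsto_ae atTop (fun n => (h n).1.aestronglyMeasurable) hu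
  have hUm : AEStronglyMeasurable U volume :=
    aestronglyMeasurable_of_tendsto_ae atTop (fun n => (h n).2.1.aestronglyMeasurable) hU
  refine hasWeakGradient_iff.2 ⟨hb.mono hum ?_, hB.mono hUm ?_, fun η hη => ?_⟩
  · filter_upwards [ae_all_iff.2 hub, hu] with x h1 h2
    exact (le_of_tendsto h2.norm (Eventually.of_forall h1)).trans (le_abs_self _)
  · filter_upwards [ae_all_iff.2 hUB, hU] with x h1 h2
    exact (le_of_tendsto h2.norm (Eventually.of_forall h1)).trans (le_abs_self _)
  have t1 : Tendsto (fun n => ∫ x, u' n x • gradient η x) atTop (𝓝 (∫ x, u x • gradient η x)) := by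
    apply tendsto_integral_of_dominated_convergence (fun x => ‖b x • gradient η x‖)
    · exact fun n => (integrable_smul_gradient (h n).1 hη).1
    · exact (integrable_smul_gradient hb hη).norm
    · intro n
      filter_upwards [hub n] with x hx
      rw [norm_smul, norm_smul]
      gcongr
      exact hx.trans (le_abs_self _)
    · filter_upwards [hu] with x hx
      exact hx.smul_const _
  have t2 : Tendsto (fun n => ∫ x, η x • U' n x) atTop (𝓝 (∫ x, η x • U x)) := by
    apply tendsto_integral_of_dominated_convergence (fun x => ‖η x • B x‖)
    · exact fun n => (hη.integrable_smul (h n).2.1).1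
    · exact (hη.integrable_smul hB).norm
    · intro n
      filter_upwards [hUB n] with x hx
      rw [norm_smul, norm_smul]
      gcongr
      exact hx.trans (le_abs_self _)
    · filter_upwards [hU] with x hx
      exact hx.const_smul _
  simp_rw [fun n => (h n).integral_eq hη] at t1
  exact tendsto_nhds_unique t1 t2.neg

end WeakGradient

/-! ### Mollification -/

section Mollify

variable {d : ℕ} {F : Type*} [NormedAddCommGroup F] [NormedSpace ℝ F]

/-- The mollification of `g`. -/
noncomputable def mollify (n : ℕ) (g : E d → F) : E d → F :=
  moll d n ⋆[ContinuousLinearMap.lsmul ℝ ℝ, volume] g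

theorem mollify_apply (n : ℕ) (g : E d → F) (x : E d) :
    mollify n g x = ∫ z, moll d n z • g (x - z) := rfl

theorem mollify_apply_swap (n : ℕ) (g : E d → F) (x : E d) :
    mollify n g x = ∫ y, moll d n (x - y) • g y := by
  rw [mollify, convolution_eq_swap]; rfl

theorem mollify_congr {g g' : E d → F} (h : g =ᵐ[volume] g') (n : ℕ) :
    mollify n g = mollify n g' :=
  convolution_congr _ EventuallyEq.rfl h

theorem ae_tendsto_mollify [CompleteSpace F] {g : E d → F} (hg : LocallyIntegrable g volume) :
    ∀ᵐ x, Tendsto (fun n => mollify n g x) atTop (𝓝 (g x)) :=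
  ae_tendsto_moll_convolution hg

theorem contDiff_mollify {g : E d → F} (hg : LocallyIntegrable g volume) (n : ℕ) :
    ContDiff ℝ ∞ (mollify n g) :=
  (moll_hasCompactSupport n).contDiff_convolution_left _ (moll_contDiff n) hg

theorem mollify_eq_zero {g : E d → F} {R : ℝ} (hg : ∀ y, R < ‖y‖ → g y = 0) {x : E d}
    (hx : R + 2 < ‖x‖) (n : ℕ) : mollify n g x = 0 := by
  rw [mollify_apply]
  refine integral_eq_zero_of_ae (ae_of_all _ fun z => ?_)
  simp only [Pi.zero_apply]
  by_cases hz : ‖z‖ ≤ 2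
  · rw [hg (x - z) (by linarith [norm_sub_norm_le x z]), smul_zero]
  · have : z ∉ tsupport (moll d n) := fun h => hz (by simpa using moll_tsupport_subset n h)
    rw [image_eq_zero_of_notMem_tsupport this, zero_smul]

theorem isTestFunction_mollify {g : E d → ℝ} (hg : LocallyIntegrable g volume) {R : ℝ}
    (hR : ∀ y, R < ‖y‖ → g y = 0) (n : ℕ) : IsTestFunction (mollify n g) :=
  ⟨contDiff_mollify hg n, HasCompactSupport.intro (isCompact_closedBall (0 : E d) (R + 2))
    fun x hx => mollify_eq_zero hR (by simpa using hx) n⟩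

theorem integrable_smul_gradient_moll {u : E d → ℝ} (hu : LocallyIntegrable u volume) (n : ℕ)
    (x : E d) : Integrable fun z => u (x - z) • gradient (moll d n) z := by
  have hu' : LocallyIntegrable (fun z => u (x - z)) volume := by
    rw [locallyIntegrable_iff]
    intro K hK
    have h1 : IntegrableOn u ((fun z => x - z) '' K) :=
      hu.integrableOn_isCompact (hK.image (by fun_prop))
    have h2 := (Measure.measurePreserving_sub_left (volume : Measure (E d))
      x).integrableOn_comp_preimage (MeasurableEquiv.subLeft x).measurableEmbedding (f := u)
      (s := (fun z => x - z) '' K)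
    rw [← h2, preimage_image_eq _ (sub_right_injective)] at h1
    exact h1
  exact integrable_smul_gradient hu' ⟨moll_contDiff n, moll_hasCompactSupport n⟩

theorem gradient_mollify_eq_integral {u : E d → ℝ} (hu : LocallyIntegrable u volume) (n : ℕ)
    (x : E d) : gradient (mollify n u) x = ∫ z, u (x - z) • gradient (moll d n) z := by
  have hint := integrable_smul_gradient_moll hu n x
  have hd := (moll_hasCompactSupport n).hasFDerivAt_convolution_left
    (ContinuousLinearMap.lsmul ℝ ℝ) ((moll_contDiff (d := d) n).of_le (by simp)) hu x
  have hex := ((moll_hasCompactSupport n).fderiv (𝕜 := ℝ)).convolutionExists_left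
    (ContinuousLinearMap.precompL (E d) (ContinuousLinearMap.lsmul ℝ ℝ : ℝ →L[ℝ] ℝ →L[ℝ] ℝ))
    ((moll_contDiff (d := d) n).continuous_fderiv (by simp)) hu x
  refine ext_inner_left ℝ fun e => ?_
  rw [← integral_inner hint, real_inner_comm, inner_gradient]
  change fderiv ℝ (moll d n ⋆[ContinuousLinearMap.lsmul ℝ ℝ, volume] u) x e = _
  rw [hd.fderiv, convolution, ContinuousLinearMap.integral_apply hex]
  refine integral_congr_ae (ae_of_all _ fun z => ?_)
  simp only
  rw [inner_smul_right, real_inner_comm, inner_gradient, ContinuousLinearMap.precompL_apply]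
  simp [mul_comm]

/-- Mollification commutes with the weak gradient. -/
theorem HasWeakGradient.gradient_mollify {u : E d → ℝ} {U : E d → E d} (h : HasWeakGradient u U)
    (n : ℕ) : gradient (mollify n u) = mollify n U := by
  funext x
  rw [gradient_mollify_eq_integral h.1, mollify_apply_swap]
  have hη : IsTestFunction fun y => moll d n (x - y) := by
    refine ⟨(moll_contDiff n).comp (contDiff_const.sub contDiff_id), ?_⟩
    exact (moll_hasCompactSupport n).comp_homeomorph (Homeomorph.subLeft x)
  have h1 := h.integral_eq hη
  rw [← neg_eq_iff_eq_neg, ← integral_neg] at h1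
  rw [← h1, ← integral_sub_left_eq_self _ volume x]
  refine integral_congr_ae (ae_of_all _ fun y => ?_)
  have : gradient (fun y => moll d n (x - y)) y = - gradient (moll d n) (x - y) := by
    have hd : HasFDerivAt (fun y => moll d n (x - y)) (-fderiv ℝ (moll d n) (x - y)) y := by
      have h2 := ((moll_contDiff n).differentiable (by simp) (x - y)).hasFDerivAt.comp y
        ((hasFDerivAt_id y).const_sub x)
      exact h2.congr_fderiv (by ext e; simp)
    simp only [gradient]
    rw [hd.fderiv, map_neg]
  simp [this]

theorem enorm_mollify_le (n : ℕ) (g : E d → F) (x : E d) :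
    ‖mollify n g x‖ₑ ≤ ∫⁻ z, ‖g (x - z)‖ₑ ∂(volume.withDensity fun z => ‖moll d n z‖ₑ) := by
  rw [lintegral_withDensity_eq_lintegral_mul_non_measurable _
    (moll_continuous n).measurable.enorm (ae_of_all _ fun _ => enorm_lt_top)]
  refine (enorm_integral_le_lintegral_enorm _).trans (le_of_eq ?_)
  simp [enorm_smul]

theorem smallOn_mollify {p : ℝ} (hp : 1 ≤ p) {δ C : ℝ≥0∞} {g : E d → F}
    (hg : StronglyMeasurable g) (h : SmallOn p δ C fun x => ‖g x‖ₑ) (n : ℕ) :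
    SmallOn p δ C fun x => ‖mollify n g x‖ₑ := by
  have hν : (volume.withDensity fun z : E d => ‖moll d n z‖ₑ) univ = 1 := by
    rw [withDensity_apply _ MeasurableSet.univ, Measure.restrict_univ, lintegral_moll]
  have h1 := SmallOn.lintegral (volume.withDensity fun z : E d => ‖moll d n z‖ₑ) hp
    (h := fun x z => ‖g (x - z)‖ₑ)
    (hg.enorm.comp (measurable_fst.sub measurable_snd)) (fun z => h.translate z)
  rw [hν, ENNReal.one_rpow, one_mul] at h1
  exact h1.mono (by linarith) fun x => enorm_mollify_le n g x

/-- The mollifications of an `L^p` function converge in `L^p` on compact sets. -/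
theorem tendsto_eLpNorm_mollify [CompleteSpace F] {p : ℝ≥0∞} (hp : 1 ≤ p) (hp' : p ≠ ⊤)
    {g : E d → F} (hg : MemLp g p volume) {K : Set (E d)} (hK : IsCompact K) :
    Tendsto (fun n => eLpNorm (mollify n g - g) p (volume.restrict K)) atTop (𝓝 0) := by
  have hloc : LocallyIntegrable g volume := hg.locallyIntegrable hp
  have : IsFiniteMeasure (volume.restrict K) := ⟨by simpa using hK.measure_lt_top⟩
  refine tendsto_Lp_finite_of_tendsto_ae hp hp'
    (fun n => (contDiff_mollify hloc n).continuous.aestronglyMeasurable) (hg.restrict K) ?_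
    (ae_restrict_of_ae (ae_tendsto_mollify hloc))
  refine UnifIntegrable.restrict ?_ K
  have hpr : 1 ≤ p.toReal := by
    rw [← ENNReal.toReal_one]; exact ENNReal.toReal_mono hp' hp
  refine unifIntegrable_of_smallOn hp hp' fun ε hε => ?_
  have hg' : MemLp (hg.1.mk g) p volume := (memLp_congr_ae hg.1.ae_eq_mk).1 hg
  obtain ⟨δ, hδ, h⟩ := exists_smallOn hp hp' hg' hε
  refine ⟨δ, hδ, fun n => ?_⟩
  rw [mollify_congr hg.1.ae_eq_mk]
  exact smallOn_mollify hpr hg.1.stronglyMeasurable_mk h n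

end Mollify

/-! ### Chain and product rules for weak gradients -/

section Calculus

variable {d : ℕ} {u v : E d → ℝ} {U V : E d → E d}

theorem locallyIntegrable_norm {F : Type*} [NormedAddCommGroup F] {μ : Measure (E d)}
    {f : E d → F} (hf : LocallyIntegrable f μ) : LocallyIntegrable (fun x => ‖f x‖) μ :=
  hf.mono hf.aestronglyMeasurable.norm (ae_of_all _ fun x => by simp)

/-- Convergence in `L^1` on a compact set `K` suffices for convergence of the integrals against a
continuous function that vanishes outside `K`. -/
theorem tendsto_integral_bilin_of_eLpNorm_restrict {F F' F'' : Type*} [NormedAddCommGroup F]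
    [NormedAddCommGroup F'] [NormedAddCommGroup F''] [NormedSpace ℝ F] [NormedSpace ℝ F']
    [NormedSpace ℝ F''] (B : F →L[ℝ] F' →L[ℝ] F'') {f : ℕ → E d → F} {g : E d → F}
    {K : Set (E d)} (hK : IsCompact K) (hf : ∀ n, LocallyIntegrable (f n) volume)
    (hg : LocallyIntegrable g volume)
    (h : Tendsto (fun n => eLpNorm (f n - g) 1 (volume.restrict K)) atTop (𝓝 0))
    {η : E d → F'} (hη : Continuous η) (hηK : ∀ x ∉ K, η x = 0) :
    Tendsto (fun n => ∫ x, B (f n x) (η x)) atTop (𝓝 (∫ x, B (g x) (η x))) := by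
  obtain ⟨M, hM⟩ := hK.exists_bound_of_continuousOn hη.continuousOn
  have hr : ∀ f : E d → F, ∫ x, B (f x) (η x) = ∫ x in K, B (f x) (η x) := fun f =>
    (setIntegral_eq_integral_of_forall_compl_eq_zero fun x hx => by simp [hηK x hx]).symm
  have hi : ∀ f : E d → F, LocallyIntegrable f volume →
      Integrable (fun x => B (f x) (η x)) (volume.restrict K) := by
    intro f hf
    refine Integrable.mono' ((hf.integrableOn_isCompact hK).norm.const_mul (‖B‖ * M))
      (B.aestronglyMeasurable_comp₂ hf.aestronglyMeasurable.restrict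
        hη.aestronglyMeasurable.restrict) ?_
    filter_upwards [ae_restrict_mem hK.measurableSet] with x hx
    calc ‖B (f x) (η x)‖ ≤ ‖B‖ * ‖f x‖ * ‖η x‖ := B.le_opNorm₂ _ _
      _ ≤ ‖B‖ * ‖f x‖ * M := by gcongr; exact hM x hx
      _ = _ := by ring
  simp_rw [hr]
  refine tendsto_integral_of_L1' _ (hi g hg).1 (Eventually.of_forall fun n => hi _ (hf n)) ?_
  have h0 : Tendsto (fun n => ENNReal.ofReal (‖B‖ * M) * eLpNorm (f n - g) 1 (volume.restrict K))
      atTop (𝓝 0) := by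
    simpa using ENNReal.Tendsto.const_mul h (Or.inr ENNReal.ofReal_ne_top)
  refine tendsto_of_tendsto_of_tendsto_of_le_of_le tendsto_const_nhds h0 (fun _ => zero_le)
    fun n => ?_
  refine eLpNorm_le_mul_eLpNorm_of_ae_le_mul ?_ 1
  filter_upwards [ae_restrict_mem hK.measurableSet] with x hx
  have : B (f n x) (η x) - B (g x) (η x) = B (f n x - g x) (η x) := by simp
  simp only [Pi.sub_apply]
  rw [this]
  calc ‖B (f n x - g x) (η x)‖ ≤ ‖B‖ * ‖f n x - g x‖ * ‖η x‖ := B.le_opNorm₂ _ _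
    _ ≤ ‖B‖ * ‖f n x - g x‖ * M := by gcongr; exact hM x hx
    _ = _ := by ring

/-- Weak gradients pass to limits in `L^1_loc`. -/
theorem hasWeakGradient_of_tendsto_eLpNorm {u' : ℕ → E d → ℝ} {U' : ℕ → E d → E d}
    (h : ∀ n, HasWeakGradient (u' n) (U' n)) (hu : LocallyIntegrable u volume)
    (hU : LocallyIntegrable U volume)
    (htu : ∀ K, IsCompact K →
      Tendsto (fun n => eLpNorm (u' n - u) 1 (volume.restrict K)) atTop (𝓝 0))
    (htU : ∀ K, IsCompact K →
      Tendsto (fun n => eLpNorm (U' n - U) 1 (volume.restrict K)) atTop (𝓝 0)) :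
    HasWeakGradient u U := by
  refine hasWeakGradient_iff.2 ⟨hu, hU, fun η hη => ?_⟩
  have t1 := tendsto_integral_bilin_of_eLpNorm_restrict (ContinuousLinearMap.lsmul ℝ ℝ) hη.2
    (fun n => (h n).1) hu (htu _ hη.2) (continuous_gradient hη.1)
    (fun x hx => gradient_eq_zero_of_notMem_tsupport hx)
  have t2 := tendsto_integral_bilin_of_eLpNorm_restrict
    (ContinuousLinearMap.lsmul ℝ ℝ : ℝ →L[ℝ] E d →L[ℝ] E d).flip hη.2
    (fun n => (h n).2.1) hU (htU _ hη.2) hη.1.continuous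
    (fun x hx => image_eq_zero_of_notMem_tsupport hx)
  simp only [ContinuousLinearMap.lsmul_apply, ContinuousLinearMap.flip_apply] at t1 t2
  simp_rw [fun n => (h n).integral_eq hη] at t1
  exact tendsto_nhds_unique t1 t2.neg

/-- The hypotheses of the chain rule: `F` is continuously differentiable on the plane, with partial
derivatives `F₁` and `F₂` bounded by `C`. -/
structure HasBddPartials (F F₁ F₂ : ℝ × ℝ → ℝ) (C : ℝ) : Prop where
  hasFDerivAt : ∀ z, HasFDerivAt F
    (F₁ z • ContinuousLinearMap.fst ℝ ℝ ℝ + F₂ z • ContinuousLinearMap.snd ℝ ℝ ℝ) z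
  continuous₁ : Continuous F₁
  continuous₂ : Continuous F₂
  bound₁ : ∀ z, |F₁ z| ≤ C
  bound₂ : ∀ z, |F₂ z| ≤ C

variable {F F₁ F₂ : ℝ × ℝ → ℝ} {C : ℝ}

theorem HasBddPartials.continuous (hF : HasBddPartials F F₁ F₂ C) : Continuous F :=
  continuous_iff_continuousAt.2 fun z => (hF.hasFDerivAt z).continuousAt

theorem HasBddPartials.norm_sub_le (hF : HasBddPartials F F₁ F₂ C) (a b a' b' : ℝ) :
    ‖F (a, b) - F (a', b')‖ ≤ C * ‖a - a'‖ + C * ‖b - b'‖ := by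
  have h1 : ‖F (a, b) - F (a', b)‖ ≤ C * ‖a - a'‖ := by
    refine convex_univ.norm_image_sub_le_of_norm_hasDerivWithin_le (f := fun t => F (t, b))
      (f' := fun t => F₁ (t, b)) (fun t _ => ?_) (fun t _ => hF.bound₁ _) (mem_univ _) (mem_univ _)
    have := (hF.hasFDerivAt (t, b)).comp_hasDerivAt t
      ((hasDerivAt_id t).prodMk (hasDerivAt_const t b))
    exact (this.congr_deriv (by simp)).hasDerivWithinAt
  have h2 : ‖F (a', b) - F (a', b')‖ ≤ C * ‖b - b'‖ := by
    refine convex_univ.norm_image_sub_le_of_norm_hasDerivWithin_le (f := fun t => F (a', t))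
      (f' := fun t => F₂ (a', t)) (fun t _ => ?_) (fun t _ => hF.bound₂ _) (mem_univ _) (mem_univ _)
    have := (hF.hasFDerivAt (a', t)).comp_hasDerivAt t
      ((hasDerivAt_const t a').prodMk (hasDerivAt_id t))
    exact (this.congr_deriv (by simp)).hasDerivWithinAt
  calc _ = ‖(F (a, b) - F (a', b)) + (F (a', b) - F (a', b'))‖ := by rw [sub_add_sub_cancel]
    _ ≤ _ := (norm_add_le _ _).trans (add_le_add h1 h2)

theorem HasBddPartials.hasFDerivAt_comp (hF : HasBddPartials F F₁ F₂ C)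
    (hu : Differentiable ℝ u) (hv : Differentiable ℝ v) (x : E d) :
    HasFDerivAt (fun x => F (u x, v x))
      (F₁ (u x, v x) • fderiv ℝ u x + F₂ (u x, v x) • fderiv ℝ v x) x := by
  have := (hF.hasFDerivAt (u x, v x)).comp x ((hu x).hasFDerivAt.prodMk (hv x).hasFDerivAt)
  refine this.congr_fderiv ?_
  ext e
  simp

theorem HasBddPartials.locallyIntegrable (hF : HasBddPartials F F₁ F₂ C)
    (hu : LocallyIntegrable u volume) (hv : LocallyIntegrable v volume) :
    LocallyIntegrable (fun x => F (u x, v x)) volume := by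
  have h0 : 0 ≤ C := (abs_nonneg _).trans (hF.bound₁ 0)
  have hb : LocallyIntegrable (fun x => ‖F (0, 0)‖ + (C * ‖u x‖ + C * ‖v x‖)) volume :=
    (locallyIntegrable_const _).add (((locallyIntegrable_norm hu).smul C).add
      ((locallyIntegrable_norm hv).smul C))
  refine hb.mono (hF.continuous.comp_aestronglyMeasurable
    (hu.aestronglyMeasurable.prodMk hv.aestronglyMeasurable)) (ae_of_all _ fun x => ?_)
  have h1 := hF.norm_sub_le (u x) (v x) 0 0
  simp only [sub_zero] at h1
  calc ‖F (u x, v x)‖ = ‖F (0, 0) + (F (u x, v x) - F (0, 0))‖ := by rw [add_sub_cancel]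
    _ ≤ ‖F (0, 0)‖ + (C * ‖u x‖ + C * ‖v x‖) := (norm_add_le _ _).trans (by gcongr)
    _ ≤ _ := le_abs_self _

theorem locallyIntegrable_bdd_smul {f : E d → ℝ} (hU : LocallyIntegrable U volume)
    (hf : AEStronglyMeasurable f volume) (hfC : ∀ x, |f x| ≤ C) :
    LocallyIntegrable (fun x => f x • U x) volume := by
  refine (hU.smul C).mono (hf.smul hU.aestronglyMeasurable) (ae_of_all _ fun x => ?_)
  rw [norm_smul, Pi.smul_apply, norm_smul]
  gcongr
  exact (hfC x).trans (le_abs_self _)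

theorem HasBddPartials.locallyIntegrable_grad (hF : HasBddPartials F F₁ F₂ C)
    (hu : LocallyIntegrable u volume) (hv : LocallyIntegrable v volume)
    (hU : LocallyIntegrable U volume) (hV : LocallyIntegrable V volume) :
    LocallyIntegrable (fun x => F₁ (u x, v x) • U x + F₂ (u x, v x) • V x) volume :=
  (locallyIntegrable_bdd_smul hU (hF.continuous₁.comp_aestronglyMeasurable
    (hu.aestronglyMeasurable.prodMk hv.aestronglyMeasurable)) fun _ => hF.bound₁ _).add
  (locallyIntegrable_bdd_smul hV (hF.continuous₂.comp_aestronglyMeasurable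
    (hu.aestronglyMeasurable.prodMk hv.aestronglyMeasurable)) fun _ => hF.bound₂ _)

/-- Products of a bounded, almost everywhere convergent sequence with a sequence converging in `L^1`
converge in `L^1`. -/
theorem tendsto_eLpNorm_bdd_smul {μ : Measure (E d)} {f : ℕ → E d → ℝ} {g : E d → ℝ}
    {W' : ℕ → E d → E d} {W : E d → E d} (hf : ∀ n, AEStronglyMeasurable (f n) μ)
    (hfC : ∀ n x, |f n x| ≤ C) (hfg : ∀ᵐ x ∂μ, Tendsto (fun n => f n x) atTop (𝓝 (g x)))
    (hW' : ∀ n, AEStronglyMeasurable (W' n) μ) (hW : MemLp W 1 μ)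
    (h : Tendsto (fun n => eLpNorm (W' n - W) 1 μ) atTop (𝓝 0)) :
    Tendsto (fun n => eLpNorm ((fun x => f n x • W' n x) - fun x => g x • W x) 1 μ)
      atTop (𝓝 0) := by
  have hg : AEStronglyMeasurable g μ := aestronglyMeasurable_of_tendsto_ae atTop hf hfg
  have t1 : Tendsto (fun n => ENNReal.ofReal C * eLpNorm (W' n - W) 1 μ) atTop (𝓝 0) := by
    simpa using ENNReal.Tendsto.const_mul h (Or.inr ENNReal.ofReal_ne_top)
  have t2 := tendsto_eLpNorm_of_dominated (μ := μ) (p := 1) one_ne_zero ENNReal.one_ne_top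
    (f := fun n x => f n x • W x) (g := fun x => g x • W x) (b := fun x => C * ‖W x‖)
    (fun n => (hf n).smul hW.1) (hg.smul hW.1) (hW.norm.const_mul C)
    (fun n => ae_of_all _ fun x => by
      rw [norm_smul]
      gcongr
      exact hfC n x) (hfg.mono fun x hx => hx.smul_const _)
  have t3 := t1.add t2
  rw [add_zero] at t3
  refine tendsto_of_tendsto_of_tendsto_of_le_of_le tendsto_const_nhds t3 (fun _ => zero_le)
    fun n => ?_
  have e : ((fun x => f n x • W' n x) - fun x => g x • W x) =
      (fun x => f n x • (W' n - W) x) + ((fun x => f n x • W x) - fun x => g x • W x) := by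
    funext x
    simp only [Pi.sub_apply, Pi.add_apply, smul_sub]
    abel
  rw [e]
  refine (eLpNorm_add_le ((hf n).smul ((hW' n).sub hW.1)) (((hf n).smul hW.1).sub (hg.smul hW.1))
    le_rfl).trans (add_le_add ?_ le_rfl)
  refine eLpNorm_le_mul_eLpNorm_of_ae_le_mul (ae_of_all _ fun x => ?_) 1
  change ‖f n x • (W' n - W) x‖ ≤ _
  rw [norm_smul]
  gcongr
  exact hfC n x

/-- The chain rule under global integrability, where it follows by mollifying both functions. -/
theorem hasWeakGradient_comp_of_integrable (hF : HasBddPartials F F₁ F₂ C)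
    (hu : HasWeakGradient u U) (hv : HasWeakGradient v V) (iu : Integrable u) (iU : Integrable U)
    (iv : Integrable v) (iV : Integrable V) :
    HasWeakGradient (fun x => F (u x, v x))
      (fun x => F₁ (u x, v x) • U x + F₂ (u x, v x) • V x) := by
  have h0 : 0 ≤ C := (abs_nonneg _).trans (hF.bound₁ 0)
  have su := fun n => contDiff_mollify hu.1 n
  have sv := fun n => contDiff_mollify hv.1 n
  have sU := fun n => contDiff_mollify hu.2.1 n
  have sV := fun n => contDiff_mollify hv.2.1 n
  have m1 : ∀ n, Continuous fun x => F₁ (mollify n u x, mollify n v x) := fun n =>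
    hF.continuous₁.comp ((su n).continuous.prodMk (sv n).continuous)
  have m2 : ∀ n, Continuous fun x => F₂ (mollify n u x, mollify n v x) := fun n =>
    hF.continuous₂.comp ((su n).continuous.prodMk (sv n).continuous)
  have hcl : ∀ n, HasWeakGradient (fun x => F (mollify n u x, mollify n v x))
      (fun x => F₁ (mollify n u x, mollify n v x) • mollify n U x +
        F₂ (mollify n u x, mollify n v x) • mollify n V x) := by
    intro n
    have hd := hF.hasFDerivAt_comp ((su n).differentiable (by simp))
      ((sv n).differentiable (by simp))
    have hg : gradient (fun x => F (mollify n u x, mollify n v x)) =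
        fun x => F₁ (mollify n u x, mollify n v x) • mollify n U x +
          F₂ (mollify n u x, mollify n v x) • mollify n V x := by
      funext x
      rw [← hu.gradient_mollify, ← hv.gradient_mollify]
      simp only [gradient]
      rw [(hd x).fderiv, map_add]
      simp
    rw [← hg]
    refine hasWeakGradient_gradient (fun x => (hd x).differentiableAt) ?_
    rw [hg]
    exact ((m1 n).smul (sU n).continuous).add ((m2 n).smul (sV n).continuous)
  have au := ae_tendsto_mollify hu.1
  have av := ae_tendsto_mollify hv.1
  refine hasWeakGradient_of_tendsto_eLpNorm hcl (hF.locallyIntegrable hu.1 hv.1)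
    (hF.locallyIntegrable_grad hu.1 hv.1 hu.2.1 hv.2.1) (fun K hK => ?_) (fun K hK => ?_)
  · have tu := tendsto_eLpNorm_mollify le_rfl ENNReal.one_ne_top (memLp_one_iff_integrable.2 iu) hK
    have tv := tendsto_eLpNorm_mollify le_rfl ENNReal.one_ne_top (memLp_one_iff_integrable.2 iv) hK
    have t := (ENNReal.Tendsto.const_mul tu (Or.inr (ENNReal.ofReal_ne_top (r := C)))).add
      (ENNReal.Tendsto.const_mul tv (Or.inr (ENNReal.ofReal_ne_top (r := C))))
    rw [mul_zero, add_zero] at t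
    refine tendsto_of_tendsto_of_tendsto_of_le_of_le tendsto_const_nhds t (fun _ => zero_le)
      fun n => ?_
    have mu : AEStronglyMeasurable (mollify n u - u) (volume.restrict K) :=
      ((su n).continuous.aestronglyMeasurable.sub hu.1.aestronglyMeasurable).restrict
    have mv : AEStronglyMeasurable (mollify n v - v) (volume.restrict K) :=
      ((sv n).continuous.aestronglyMeasurable.sub hv.1.aestronglyMeasurable).restrict
    calc _ ≤ eLpNorm ((fun x => C * ‖(mollify n u - u) x‖) + fun x => C * ‖(mollify n v - v) x‖) 1
          (volume.restrict K) := eLpNorm_mono_real fun x => hF.norm_sub_le _ _ _ _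
      _ ≤ _ := eLpNorm_add_le (mu.norm.const_mul C) (mv.norm.const_mul C) le_rfl
      _ ≤ _ := by
        gcongr
        · exact eLpNorm_le_mul_eLpNorm_of_ae_le_mul (ae_of_all _ fun x => by
            simp [abs_of_nonneg h0]) 1
        · exact eLpNorm_le_mul_eLpNorm_of_ae_le_mul (ae_of_all _ fun x => by
            simp [abs_of_nonneg h0]) 1
  · have auv : ∀ᵐ x ∂(volume.restrict K), Tendsto (fun n => (mollify n u x, mollify n v x)) atTop
        (𝓝 (u x, v x)) := ae_restrict_of_ae (by
      filter_upwards [au, av] with x h1 h2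
      exact h1.prodMk_nhds h2)
    have t1 := tendsto_eLpNorm_bdd_smul (μ := volume.restrict K)
      (fun n => (m1 n).aestronglyMeasurable) (fun n x => hF.bound₁ _)
      (auv.mono fun x hx => (hF.continuous₁.tendsto _).comp hx)
      (fun n => (sU n).continuous.aestronglyMeasurable)
      ((memLp_one_iff_integrable.2 iU).restrict K)
      (tendsto_eLpNorm_mollify le_rfl ENNReal.one_ne_top (memLp_one_iff_integrable.2 iU) hK)
    have t2 := tendsto_eLpNorm_bdd_smul (μ := volume.restrict K)
      (fun n => (m2 n).aestronglyMeasurable) (fun n x => hF.bound₂ _)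
      (auv.mono fun x hx => (hF.continuous₂.tendsto _).comp hx)
      (fun n => (sV n).continuous.aestronglyMeasurable)
      ((memLp_one_iff_integrable.2 iV).restrict K)
      (tendsto_eLpNorm_mollify le_rfl ENNReal.one_ne_top (memLp_one_iff_integrable.2 iV) hK)
    have t := t1.add t2
    rw [add_zero] at t
    refine tendsto_of_tendsto_of_tendsto_of_le_of_le tendsto_const_nhds t (fun _ => zero_le)
      fun n => ?_
    have muv : AEStronglyMeasurable (fun x => (u x, v x)) (volume.restrict K) :=
      (hu.1.aestronglyMeasurable.prodMk hv.1.aestronglyMeasurable).restrict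
    refine le_trans (le_of_eq ?_) (eLpNorm_add_le
      (((m1 n).smul (sU n).continuous).aestronglyMeasurable.sub
        ((hF.continuous₁.comp_aestronglyMeasurable muv).smul hu.2.1.aestronglyMeasurable.restrict))
      (((m2 n).smul (sV n).continuous).aestronglyMeasurable.sub
        ((hF.continuous₂.comp_aestronglyMeasurable muv).smul hv.2.1.aestronglyMeasurable.restrict))
      le_rfl)
    congr 1
    funext x
    simp only [Pi.sub_apply, Pi.add_apply]
    abel

/-- The chain rule for a function of two weakly differentiable functions. -/
theorem HasBddPartials.hasWeakGradient (hF : HasBddPartials F F₁ F₂ C)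
    (hu : HasWeakGradient u U) (hv : HasWeakGradient v V) :
    HasWeakGradient (fun x => F (u x, v x))
      (fun x => F₁ (u x, v x) • U x + F₂ (u x, v x) • V x) := by
  refine hasWeakGradient_iff.2 ⟨hF.locallyIntegrable hu.1 hv.1,
    hF.locallyIntegrable_grad hu.1 hv.1 hu.2.1 hv.2.1, fun η hη => ?_⟩
  -- a cut-off that equals one near the support of `η` reduces to integrable functions
  obtain ⟨R, hR⟩ := hη.2.isBounded.exists_norm_le
  obtain ⟨n, hn⟩ := exists_nat_gt R
  have hn' : ∀ x ∈ tsupport η, ‖x‖ < (n : ℝ) + 1 := fun x hx => by linarith [hR x hx]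
  have hχ := cutoff_isTestFunction (d := d) n
  have iχ : ∀ {w : E d → ℝ} {W : E d → E d}, HasWeakGradient w W →
      Integrable (fun x => cutoff d n x • W x + w x • gradient (cutoff d n) x) :=
    fun h => (hχ.integrable_smul h.2.1).add (integrable_smul_gradient h.1 hχ)
  have key := (hasWeakGradient_comp_of_integrable hF (hu.smooth_mul hχ.1) (hv.smooth_mul hχ.1)
    (hχ.integrable_smul hu.1) (iχ hu) (hχ.integrable_smul hv.1) (iχ hv)).integral_eq hη
  have e1 : ∀ x, F (cutoff d n x * u x, cutoff d n x * v x) • gradient η x =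
      F (u x, v x) • gradient η x := by
    intro x
    by_cases hx : x ∈ tsupport η
    · rw [cutoff_eq_one (hn' x hx), one_mul, one_mul]
    · rw [gradient_eq_zero_of_notMem_tsupport hx, smul_zero, smul_zero]
  simp_rw [e1] at key
  rw [key]
  congr 1
  refine integral_congr_ae (ae_of_all _ fun x => ?_)
  by_cases hx : x ∈ tsupport η
  · simp [cutoff_eq_one (hn' x hx), gradient_cutoff_eq_zero (hn' x hx)]
  · simp [image_eq_zero_of_notMem_tsupport hx]

/-- A smooth bounded approximation of the identity of the line: `(n + 1) sin (t / (n + 1))`. -/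
noncomputable def sinTrunc (n : ℕ) (t : ℝ) : ℝ := ((n : ℝ) + 1) * Real.sin (t / ((n : ℝ) + 1))

theorem hasDerivAt_sinTrunc (n : ℕ) (t : ℝ) :
    HasDerivAt (sinTrunc n) (Real.cos (t / ((n : ℝ) + 1))) t := by
  have h0 : (n : ℝ) + 1 ≠ 0 := n.cast_add_one_ne_zero
  have := (((hasDerivAt_id t).div_const ((n : ℝ) + 1)).sin).const_mul ((n : ℝ) + 1)
  refine this.congr_deriv ?_
  simp only [id]
  field_simp

theorem continuous_sinTrunc (n : ℕ) : Continuous (sinTrunc n) := by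
  unfold sinTrunc; fun_prop

theorem abs_sinTrunc_le (n : ℕ) (t : ℝ) : |sinTrunc n t| ≤ |t| := by
  have h0 : (0 : ℝ) < (n : ℝ) + 1 := n.cast_add_one_pos
  rw [sinTrunc, abs_mul, abs_of_pos h0]
  calc ((n : ℝ) + 1) * |Real.sin (t / ((n : ℝ) + 1))| ≤ ((n : ℝ) + 1) * |t / ((n : ℝ) + 1)| :=
        mul_le_mul_of_nonneg_left Real.abs_sin_le_abs h0.le
    _ = |t| := by rw [abs_div, abs_of_pos h0]; field_simp

theorem abs_sinTrunc_le_nat (n : ℕ) (t : ℝ) : |sinTrunc n t| ≤ (n : ℝ) + 1 := by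
  have h0 : (0 : ℝ) < (n : ℝ) + 1 := n.cast_add_one_pos
  rw [sinTrunc, abs_mul, abs_of_pos h0]
  exact mul_le_of_le_one_right h0.le (Real.abs_sin_le_one _)

theorem tendsto_cos_div (t : ℝ) :
    Tendsto (fun n : ℕ => Real.cos (t / ((n : ℝ) + 1))) atTop (𝓝 1) := by
  have h1 : Tendsto (fun n : ℕ => t / ((n : ℝ) + 1)) atTop (𝓝 0) := by
    have := (tendsto_one_div_add_atTop_nhds_zero_nat (𝕜 := ℝ)).const_mul t
    simpa [div_eq_mul_inv] using this
  have := (Real.continuous_cos.tendsto 0).comp h1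
  rwa [Real.cos_zero] at this

theorem tendsto_sinTrunc (t : ℝ) : Tendsto (fun n => sinTrunc n t) atTop (𝓝 t) := by
  have h1 : Tendsto (fun n : ℕ => t / ((n : ℝ) + 1)) atTop (𝓝 0) := by
    have := (tendsto_one_div_add_atTop_nhds_zero_nat (𝕜 := ℝ)).const_mul t
    simpa [div_eq_mul_inv] using this
  have h2 : Tendsto (fun n : ℕ => t * Real.sinc (t / ((n : ℝ) + 1))) atTop (𝓝 (t * 1)) := by
    have := (Real.continuous_sinc.tendsto 0).comp h1
    rw [Real.sinc_zero] at this
    exact this.const_mul t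
  rw [mul_one] at h2
  refine h2.congr fun n => ?_
  have h0 : (n : ℝ) + 1 ≠ 0 := n.cast_add_one_ne_zero
  rcases eq_or_ne t 0 with rfl | ht
  · simp [sinTrunc]
  · rw [Real.sinc_of_ne_zero (div_ne_zero ht h0), sinTrunc]
    field_simp

/-- The product rule. -/
theorem HasWeakGradient.mul (hu : HasWeakGradient u U) (hv : HasWeakGradient v V)
    (h1 : LocallyIntegrable (fun x => u x * v x) volume)
    (h2 : LocallyIntegrable (fun x => u x • V x) volume)
    (h3 : LocallyIntegrable (fun x => v x • U x) volume) :
    HasWeakGradient (fun x => u x * v x) (fun x => u x • V x + v x • U x) := by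
  have hF : ∀ n : ℕ, HasBddPartials (fun z => sinTrunc n z.1 * sinTrunc n z.2)
      (fun z => sinTrunc n z.2 * Real.cos (z.1 / ((n : ℝ) + 1)))
      (fun z => sinTrunc n z.1 * Real.cos (z.2 / ((n : ℝ) + 1))) ((n : ℝ) + 1) := by
    intro n
    have hs := continuous_sinTrunc n
    have hb : ∀ s t : ℝ, |sinTrunc n s * Real.cos t| ≤ (n : ℝ) + 1 := by
      intro s t
      rw [abs_mul]
      calc _ ≤ ((n : ℝ) + 1) * 1 := by
            gcongr
            · exact abs_sinTrunc_le_nat n s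
            · exact Real.abs_cos_le_one t
        _ = _ := mul_one _
    refine ⟨fun z => ?_, by fun_prop, by fun_prop, fun z => hb _ _, fun z => hb _ _⟩
    have e1 := (hasDerivAt_sinTrunc n z.1).comp_hasFDerivAt z
      (ContinuousLinearMap.fst ℝ ℝ ℝ).hasFDerivAt
    have e2 := (hasDerivAt_sinTrunc n z.2).comp_hasFDerivAt z
      (ContinuousLinearMap.snd ℝ ℝ ℝ).hasFDerivAt
    refine (e1.mul e2).congr_fderiv ?_
    ext <;> simp
  have hb : ∀ (n : ℕ) (s t : ℝ) (e : E d),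
      ‖(sinTrunc n s * Real.cos (t / ((n : ℝ) + 1))) • e‖ ≤ ‖s • e‖ := by
    intro n s t e
    rw [norm_smul, norm_smul, norm_mul]
    gcongr
    calc _ ≤ |s| * 1 :=
          mul_le_mul (abs_sinTrunc_le n s) (Real.abs_cos_le_one _) (abs_nonneg _) (abs_nonneg _)
      _ = _ := mul_one _
  refine hasWeakGradient_of_tendsto (fun n => (hF n).hasWeakGradient hu hv)
    (locallyIntegrable_norm h1)
    ((locallyIntegrable_norm h3).add (locallyIntegrable_norm h2))
    (fun n => ae_of_all _ fun x => ?_) (fun n => ae_of_all _ fun x => ?_)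
    (ae_of_all _ fun x => ?_) (ae_of_all _ fun x => ?_)
  · rw [norm_mul, norm_mul]
    gcongr <;> exact abs_sinTrunc_le _ _
  · refine (norm_add_le _ _).trans (add_le_add ?_ ?_)
    · exact hb n (v x) (u x) (U x)
    · exact hb n (u x) (v x) (V x)
  · exact (tendsto_sinTrunc _).mul (tendsto_sinTrunc _)
  · have := (((tendsto_sinTrunc (v x)).mul (tendsto_cos_div (u x))).smul_const (U x)).add
      (((tendsto_sinTrunc (u x)).mul (tendsto_cos_div (v x))).smul_const (V x))
    simpa [add_comm] using this

end Calculus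

/-! ### Uniform integrability of weighted mollified gradients -/

section Commutator

variable {d : ℕ}

theorem SmallOn.anti_left {p : ℝ} {δ δ' C : ℝ≥0∞} {g : E d → ℝ≥0∞} (h : SmallOn p δ C g)
    (hδ : δ' ≤ δ) : SmallOn p δ' C g := fun A hA hAδ => h A hA (hAδ.trans hδ)

theorem SmallOn.mono_right {p : ℝ} {δ C C' : ℝ≥0∞} {g : E d → ℝ≥0∞} (h : SmallOn p δ C g)
    (hC : C ≤ C') : SmallOn p δ C' g := fun A hA hAδ => (h A hA hAδ).trans hC

theorem SmallOn.add {p : ℝ} (hp : 1 ≤ p) {δ C C' : ℝ≥0∞} {g g' : E d → ℝ≥0∞} (hg : Measurable g)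
    (h : SmallOn p δ C g) (h' : SmallOn p δ C' g') :
    SmallOn p δ (2 ^ (p - 1) * (C + C')) fun x => g x + g' x := by
  intro A hA hAδ
  calc ∫⁻ x in A, (g x + g' x) ^ p
      ≤ ∫⁻ x in A, 2 ^ (p - 1) * (g x ^ p + g' x ^ p) :=
        lintegral_mono fun x => ENNReal.rpow_add_le_mul_rpow_add_rpow _ _ hp
    _ = 2 ^ (p - 1) * ((∫⁻ x in A, g x ^ p) + ∫⁻ x in A, g' x ^ p) := by
        rw [lintegral_const_mul' _ _ (ENNReal.rpow_ne_top_of_nonneg (by linarith) (by simp)),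
          lintegral_add_left (hg.pow_const p)]
    _ ≤ _ := by
        gcongr
        · exact h A hA hAδ
        · exact h' A hA hAδ

theorem enorm_sub_le_lintegral_gradient {u : E d → ℝ} (hu : ContDiff ℝ ∞ u) (x z : E d) :
    ‖u x - u (x - z)‖ₑ ≤ ‖z‖ₑ * ∫⁻ t : ℝ in Ioc 0 1, ‖gradient u (x - t • z)‖ₑ := by
  have hd : ∀ t : ℝ, HasDerivAt (fun t : ℝ => u (x - t • z))
      (-inner ℝ (gradient u (x - t • z)) z) t := by
    intro t
    have h1 : HasDerivAt (fun t : ℝ => x - t • z) (-z) t := by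
      simpa using ((hasDerivAt_id t).smul_const z).const_sub x
    have h2 := (hu.differentiable (by simp) (x - t • z)).hasFDerivAt.comp_hasDerivAt t h1
    refine h2.congr_deriv ?_
    rw [map_neg, inner_gradient]
  have hc : Continuous fun t : ℝ => -inner ℝ (gradient u (x - t • z)) z := by
    have := continuous_gradient hu
    fun_prop
  have h := intervalIntegral.integral_eq_sub_of_hasDerivAt (a := 0) (b := 1) (fun t _ => hd t)
    (hc.intervalIntegrable _ _)
  simp only [one_smul, zero_smul, sub_zero] at h
  rw [enorm_sub_rev, ← h, intervalIntegral.integral_of_le zero_le_one]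
  refine (enorm_integral_le_lintegral_enorm _).trans ?_
  rw [← lintegral_const_mul' _ _ enorm_ne_top]
  refine lintegral_mono fun t => ?_
  simp only [enorm_neg]
  rw [← ofReal_norm, ← ofReal_norm, ← ofReal_norm, ← ENNReal.ofReal_mul (norm_nonneg _), mul_comm]
  exact ENNReal.ofReal_le_ofReal (norm_inner_le_norm _ _)

/-- The difference quotients of a weakly differentiable function are, uniformly in the increment,
as small over small sets as the weak gradient. -/
theorem HasWeakGradient.smallOn_sub {p : ℝ} (hp : 1 ≤ p) {δ C : ℝ≥0∞} {φ : E d → ℝ}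
    {G : E d → E d} (h : HasWeakGradient φ G) (hG : StronglyMeasurable G)
    (hC : SmallOn p δ C fun x => ‖G x‖ₑ) (z : E d) :
    SmallOn p δ (‖z‖ₑ ^ p * C) fun x => ‖φ x - φ (x - z)‖ₑ := by
  have hp0 : 0 ≤ p := by linarith
  have hsm := fun n => contDiff_mollify h.1 n
  have h1 : ∀ n, SmallOn p δ (‖z‖ₑ ^ p * C)
      fun x => ‖mollify n φ x - mollify n φ (x - z)‖ₑ := by
    intro n
    have hc : Continuous (mollify n G) := (contDiff_mollify h.2.1 n).continuous
    have hm : Measurable (Function.uncurry fun (x : E d) (t : ℝ) =>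
        ‖mollify n G (x - t • z)‖ₑ) := by
      have : Continuous fun q : E d × ℝ => mollify n G (q.1 - q.2 • z) := by fun_prop
      exact this.measurable.enorm
    have h2 := SmallOn.lintegral (volume.restrict (Ioc (0 : ℝ) 1)) hp hm
      fun t => (smallOn_mollify hp hG hC n).translate (t • z)
    have h3 := h2.const_mul hp0 ‖z‖ₑ hm.lintegral_prod_right'
    simp only [Measure.restrict_apply_univ, Real.volume_Ioc, sub_zero, ENNReal.ofReal_one,
      ENNReal.one_rpow, one_mul] at h3
    refine h3.mono hp0 fun x => ?_
    have := enorm_sub_le_lintegral_gradient (hsm n) x z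
    rwa [h.gradient_mollify] at this
  intro A hA hAδ
  have a1 := ae_tendsto_mollify h.1
  have a2 : ∀ᵐ x, Tendsto (fun n => mollify n φ (x - z)) atTop (𝓝 (φ (x - z))) :=
    (measurePreserving_sub_right volume z).quasiMeasurePreserving.ae a1
  calc ∫⁻ x in A, ‖φ x - φ (x - z)‖ₑ ^ p
      = ∫⁻ x in A, liminf (fun n => ‖mollify n φ x - mollify n φ (x - z)‖ₑ ^ p) atTop := by
        refine lintegral_congr_ae (ae_restrict_of_ae ?_)
        filter_upwards [a1, a2] with x h1 h2
        exact ((h1.sub h2).enorm.ennrpow_const p).liminf_eq.symm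
    _ ≤ liminf (fun n => ∫⁻ x in A, ‖mollify n φ x - mollify n φ (x - z)‖ₑ ^ p) atTop := by
        refine lintegral_liminf_le fun n => ?_
        have := (hsm n).continuous
        have : Continuous fun x => mollify n φ x - mollify n φ (x - z) := by fun_prop
        exact this.measurable.enorm.pow_const p
    _ ≤ ‖z‖ₑ ^ p * C :=
        liminf_le_of_frequently_le' (Frequently.of_forall fun n => h1 n A hA hAδ)

/-- The commutator estimate behind the density of test functions: the product `φ ∇(ρ_n ⋆ f)` differs
from `∇(ρ_n ⋆ (f φ))` by an integral of differences of `φ` against `f ∇ρ_n`. -/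
theorem enorm_smul_mollify_le {φ f : E d → ℝ} {v J : E d → E d} {M : ℝ}
    (hM : ∀ x, |f x| ≤ M) (hf : HasWeakGradient f v)
    (hJ : HasWeakGradient (fun x => f x * φ x) J) (n : ℕ) (x : E d) :
    ‖φ x • mollify n v x‖ₑ ≤ ‖mollify n J x‖ₑ +
      ∫⁻ z, ENNReal.ofReal M * ‖z‖ₑ⁻¹ * ‖φ x - φ (x - z)‖ₑ
        ∂(volume.withDensity fun z => ‖gradient (moll d n) z‖ₑ * ‖z‖ₑ) := by
  have i1 : Integrable fun z => φ x • f (x - z) • gradient (moll d n) z :=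
    (integrable_smul_gradient_moll hf.1 n x).smul (φ x)
  have i2 := integrable_smul_gradient_moll hJ.1 n x
  have hgm : Measurable fun z : E d => ‖gradient (moll d n) z‖ₑ :=
    (continuous_gradient (moll_contDiff n)).measurable.enorm
  have hwm : Measurable fun z : E d => ‖gradient (moll d n) z‖ₑ * ‖z‖ₑ := hgm.mul measurable_enorm
  have e : φ x • mollify n v x = mollify n J x +
      ∫ z, (f (x - z) * (φ x - φ (x - z))) • gradient (moll d n) z := by
    rw [← hf.gradient_mollify, ← hJ.gradient_mollify, gradient_mollify_eq_integral hf.1,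
      gradient_mollify_eq_integral hJ.1, ← integral_smul, ← sub_eq_iff_eq_add',
      ← integral_sub i1 i2]
    refine integral_congr_ae (ae_of_all _ fun z => ?_)
    module
  rw [e]
  refine (enorm_add_le _ _).trans (add_le_add le_rfl ?_)
  refine (enorm_integral_le_lintegral_enorm _).trans ?_
  rw [lintegral_withDensity_eq_lintegral_mul_non_measurable _ hwm
    (ae_of_all _ fun z => by simp [ENNReal.mul_lt_top])]
  refine lintegral_mono fun z => ?_
  simp only [Pi.mul_apply]
  -- at `z = 0` the factor `‖z‖ₑ⁻¹` is infinite, but both sides vanish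
  rcases eq_or_ne z 0 with rfl | hz
  · simp
  · have hz' : ‖z‖ₑ ≠ 0 := by simpa using hz
    rw [enorm_smul, enorm_mul]
    have hfM : ‖f (x - z)‖ₑ ≤ ENNReal.ofReal M := by
      rw [← ofReal_norm]; exact ENNReal.ofReal_le_ofReal (hM _)
    calc ‖f (x - z)‖ₑ * ‖φ x - φ (x - z)‖ₑ * ‖gradient (moll d n) z‖ₑ
        ≤ ENNReal.ofReal M * ‖φ x - φ (x - z)‖ₑ * ‖gradient (moll d n) z‖ₑ := by gcongr
      _ = ENNReal.ofReal M * ‖φ x - φ (x - z)‖ₑ * ‖gradient (moll d n) z‖ₑ *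
          (‖z‖ₑ * ‖z‖ₑ⁻¹) := by rw [ENNReal.mul_inv_cancel hz' enorm_ne_top, mul_one]
      _ = _ := by ring

/-- The products `φ ∇(ρ_n ⋆ f)` are uniformly integrable in `L^p(dx)` if `f` is bounded and `∇φ` and
`J = ∇(f φ)` lie in `L^p(dx)`; the function `φ ∇f` itself does not enter. -/
theorem unifIntegrable_smul_mollify {p : ℝ≥0∞} (hp : 1 ≤ p) (hp' : p ≠ ⊤) {φ f : E d → ℝ}
    {G v J : E d → E d} {M : ℝ} (hφm : StronglyMeasurable φ) (hφ : HasWeakGradient φ G)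
    (hGm : StronglyMeasurable G) (hG : MemLp G p volume) (hM : ∀ x, |f x| ≤ M)
    (hf : HasWeakGradient f v) (hJm : StronglyMeasurable J)
    (hJ : HasWeakGradient (fun x => f x * φ x) J) (hJp : MemLp J p volume) :
    UnifIntegrable (fun n x => φ x • mollify n v x) p volume := by
  have hr : 1 ≤ p.toReal := by
    rw [← ENNReal.toReal_one]; exact ENNReal.toReal_mono hp' hp
  have hr0 : 0 ≤ p.toReal := by linarith
  obtain ⟨K, hK, hKn⟩ := exists_lintegral_gradient_moll_le d
  -- `κ` is the factor lost between `∇φ`, `J` and the weighted mollified gradients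
  set κ : ℝ≥0∞ := 2 ^ (p.toReal - 1) * (1 + K ^ p.toReal * ENNReal.ofReal M ^ p.toReal) with hκ
  have hκ0 : κ ≠ 0 := by
    simp [hκ]
  have hκt : κ ≠ ⊤ := by
    refine ENNReal.mul_ne_top (ENNReal.rpow_ne_top_of_nonneg (by linarith) (by simp)) ?_
    refine ENNReal.add_ne_top.2 ⟨by simp, ENNReal.mul_ne_top ?_ ?_⟩
    · exact ENNReal.rpow_ne_top_of_nonneg hr0 hK
    · exact ENNReal.rpow_ne_top_of_nonneg hr0 ENNReal.ofReal_ne_top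
  refine unifIntegrable_of_smallOn hp hp' fun ε hε => ?_
  have hκr : 0 < κ.toReal := ENNReal.toReal_pos hκ0 hκt
  set C : ℝ≥0∞ := ENNReal.ofReal (ε / κ.toReal) with hC
  have hCκ : κ * C = ENNReal.ofReal ε := by
    rw [hC, ← ENNReal.ofReal_toReal hκt, ← ENNReal.ofReal_mul hκr.le, ENNReal.toReal_ofReal hκr.le]
    congr 1
    field_simp
  obtain ⟨δ₁, hδ₁, h₁⟩ := exists_smallOn hp hp' hG (div_pos hε hκr)
  obtain ⟨δ₂, hδ₂, h₂⟩ := exists_smallOn hp hp' hJp (div_pos hε hκr)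
  refine ⟨min δ₁ δ₂, lt_min hδ₁ hδ₂, fun n => ?_⟩
  replace h₁ := h₁.anti_left (ENNReal.ofReal_le_ofReal (min_le_left δ₁ δ₂))
  replace h₂ := h₂.anti_left (ENNReal.ofReal_le_ofReal (min_le_right δ₁ δ₂))
  have hΔ : Measurable fun q : E d × E d => ‖φ q.1 - φ (q.1 - q.2)‖ₑ :=
    ((hφm.measurable.comp measurable_fst).sub
      (hφm.measurable.comp (measurable_fst.sub measurable_snd))).enorm
  have hz : ∀ z : E d, SmallOn p.toReal (ENNReal.ofReal (min δ₁ δ₂))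
      (ENNReal.ofReal M ^ p.toReal * C)
      fun x => ENNReal.ofReal M * ‖z‖ₑ⁻¹ * ‖φ x - φ (x - z)‖ₑ := by
    intro z
    refine ((hφ.smallOn_sub hr hGm h₁ z).const_mul hr0 (ENNReal.ofReal M * ‖z‖ₑ⁻¹)
      (hΔ.comp (measurable_id.prodMk measurable_const))).mono_right ?_
    rcases eq_or_ne z 0 with rfl | hz
    · simp [show 0 < p.toReal by linarith]
    · have hz' : ‖z‖ₑ ≠ 0 := by simpa using hz
      rw [ENNReal.mul_rpow_of_nonneg _ _ hr0, ← mul_assoc, mul_assoc (ENNReal.ofReal M ^ _),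
        ← ENNReal.mul_rpow_of_nonneg _ _ hr0, ENNReal.inv_mul_cancel hz' enorm_ne_top,
        ENNReal.one_rpow, mul_one]
  have hm : Measurable (Function.uncurry fun x z : E d =>
      ENNReal.ofReal M * ‖z‖ₑ⁻¹ * ‖φ x - φ (x - z)‖ₑ) :=
    (measurable_snd.enorm.inv.const_mul _).mul hΔ
  have h₃ := SmallOn.lintegral (volume.withDensity fun z => ‖gradient (moll d n) z‖ₑ * ‖z‖ₑ) hr
    hm hz
  have hν : (volume.withDensity fun z : E d => ‖gradient (moll d n) z‖ₑ * ‖z‖ₑ) univ ≤ K := by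
    rw [withDensity_apply _ MeasurableSet.univ, Measure.restrict_univ]
    exact hKn n
  have h₄ := SmallOn.add hr (contDiff_mollify hJ.2.1 n).continuous.measurable.enorm
    (smallOn_mollify hr hJm h₂ n) h₃
  refine (h₄.mono hr0 fun x => enorm_smul_mollify_le hM hf hJ n x).mono_right ?_
  rw [← hCκ, hκ, ← hC, mul_assoc]
  gcongr
  rw [add_mul, one_mul, mul_assoc]
  gcongr

/-- Weighted `L^p` convergence of the gradients of the mollifications of a bounded function. -/
theorem tendsto_eLpNorm_smul_mollify {p : ℝ≥0∞} (hp : 1 ≤ p) (hp' : p ≠ ⊤) {φ f : E d → ℝ}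
    {G v J : E d → E d} {M : ℝ} (hφ : HasWeakGradient φ G) (hG : MemLp G p volume)
    (hM : ∀ x, |f x| ≤ M) (hf : HasWeakGradient f v)
    (hJ : HasWeakGradient (fun x => f x * φ x) J) (hJp : MemLp J p volume)
    (hv : MemLp (fun x => φ x • v x) p volume) {K : Set (E d)} (hK : IsCompact K) :
    Tendsto (fun n => eLpNorm (fun x => φ x • (mollify n v x - v x)) p (volume.restrict K))
      atTop (𝓝 0) := by
  have : IsFiniteMeasure (volume.restrict K) := ⟨by simpa using hK.measure_lt_top⟩
  have hφm := hφ.1.aestronglyMeasurable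
  have e0 := hφm.ae_eq_mk
  have hui : UnifIntegrable (fun n x => φ x • mollify n v x) p volume := by
    have h1 := unifIntegrable_smul_mollify hp hp' hφm.stronglyMeasurable_mk
      (hφ.congr_ae e0 hG.1.ae_eq_mk) hG.1.stronglyMeasurable_mk
      ((memLp_congr_ae hG.1.ae_eq_mk).1 hG) hM hf hJp.1.stronglyMeasurable_mk
      (hJ.congr_ae (e0.mono fun x hx => by simp only [hx]) hJp.1.ae_eq_mk)
      ((memLp_congr_ae hJp.1.ae_eq_mk).1 hJp)
    exact h1.ae_eq fun n => e0.mono fun x hx => by simp only [hx]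
  have := tendsto_Lp_finite_of_tendsto_ae hp hp' (μ := volume.restrict K)
    (f := fun n x => φ x • mollify n v x) (g := fun x => φ x • v x)
    (fun n => (hφm.smul (contDiff_mollify hf.2.1 n).continuous.aestronglyMeasurable).restrict)
    (hv.restrict K) (hui.restrict K)
    (ae_restrict_of_ae ((ae_tendsto_mollify hf.2.1).mono fun x hx => hx.const_smul _))
  refine this.congr fun n => ?_
  congr 1
  funext x
  simp [smul_sub]

end Commutator

/-! ### Regular weights -/

section Weight

/-- The standing hypotheses on the weight: `p` is finite, `w` is a nonnegative locally integrable
function, and the conditions (Reg) and (Diff) hold. -/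
structure IsRegularWeight {d : ℕ} (p : ℝ≥0∞) (w : E d → ℝ) (G : E d → E d) : Prop where
  one_le : 1 ≤ p
  ne_top : p ≠ ⊤
  locInt : LocallyIntegrable w volume
  nonneg : ∀ᵐ x ∂volume, 0 ≤ w x
  reg : Reg p w
  diff : Diff p w G

theorem holderConjugate_conjExp {p : ℝ≥0∞} (hp : 1 ≤ p) (hp' : p ≠ ⊤) :
    p.HolderConjugate (conjExp p) := by
  rw [ENNReal.isConjExponent_iff_eq_conjExponent hp, conjExp]
  rcases hp.eq_or_lt with rfl | h
  · simp
  · have h0 : p - 1 ≠ 0 := (tsub_pos_of_lt h).ne'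
    have ht : p - 1 ≠ ⊤ := ENNReal.sub_ne_top hp'
    calc p / (p - 1) = (1 + (p - 1)) / (p - 1) := by rw [add_tsub_cancel_of_le hp]
      _ = 1 + (p - 1)⁻¹ := by rw [ENNReal.add_div, ENNReal.div_self h0 ht, one_div, add_comm]

theorem ae_of_forall_isCompact {d : ℕ} {P : E d → Prop}
    (h : ∀ K : Set (E d), IsCompact K → ∀ᵐ x ∂(volume.restrict K), P x) : ∀ᵐ x, P x := by
  have h1 : ∀ᵐ x ∂((volume : Measure (E d)).restrict (⋃ n : ℕ, Metric.closedBall (0 : E d) n)),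
      P x := (ae_restrict_iUnion_iff _ _).2 fun n => h _ (isCompact_closedBall _ _)
  rwa [Metric.iUnion_closedBall_nat, Measure.restrict_univ] at h1

variable {d : ℕ} {p : ℝ≥0∞} {w : E d → ℝ} {G : E d → E d}

namespace IsRegularWeight

theorem toReal_pos (h : IsRegularWeight p w G) : 0 < p.toReal :=
  ENNReal.toReal_pos (zero_lt_one.trans_le h.one_le).ne' h.ne_top

theorem one_le_toReal (h : IsRegularWeight p w G) : 1 ≤ p.toReal := by
  rw [← ENNReal.toReal_one]; exact ENNReal.toReal_mono h.ne_top h.one_le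

theorem ne_zero (h : IsRegularWeight p w G) : p ≠ 0 := (zero_lt_one.trans_le h.one_le).ne'

theorem holder (h : IsRegularWeight p w G) : p.HolderConjugate (conjExp p) :=
  holderConjugate_conjExp h.one_le h.ne_top

theorem hasWeakGradient_phi (h : IsRegularWeight p w G) : HasWeakGradient (phi p w) G :=
  h.diff.2.2.1

theorem aestronglyMeasurable_phi (h : IsRegularWeight p w G) :
    AEStronglyMeasurable (phi p w) volume := h.hasWeakGradient_phi.1.aestronglyMeasurable

theorem aemeasurable_ofReal (h : IsRegularWeight p w G) :
    AEMeasurable (fun x => ENNReal.ofReal (w x)) volume :=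
  h.locInt.aestronglyMeasurable.aemeasurable.ennreal_ofReal

theorem phi_rpow (h : IsRegularWeight p w G) : ∀ᵐ x, phi p w x ^ p.toReal = w x := by
  filter_upwards [h.nonneg] with x hx
  rw [phi, ← Real.rpow_mul hx, one_div_mul_cancel h.toReal_pos.ne', Real.rpow_one]

theorem phi_nonneg (h : IsRegularWeight p w G) : ∀ᵐ x, 0 ≤ phi p w x := by
  filter_upwards [h.nonneg] with x hx
  exact Real.rpow_nonneg hx _

theorem conjExp_ne_top (h : IsRegularWeight p w G) (hp : p ≠ 1) : conjExp p ≠ ⊤ :=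
  ENNReal.div_ne_top h.ne_top (tsub_pos_of_lt (h.one_le.lt_of_ne' hp)).ne'

theorem one_le_conjExp (h : IsRegularWeight p w G) : 1 ≤ conjExp p := by
  have := h.holder.symm
  exact ENNReal.HolderConjugate.one_le (conjExp p) p

theorem conjExp_toReal_pos (h : IsRegularWeight p w G) (hp : p ≠ 1) : 0 < (conjExp p).toReal :=
  ENNReal.toReal_pos (zero_lt_one.trans_le h.one_le_conjExp).ne' (h.conjExp_ne_top hp)

/-- By (Reg), the weight is positive almost everywhere. -/
theorem phi_pos (h : IsRegularWeight p w G) : ∀ᵐ x, 0 < phi p w x := by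
  refine ae_of_forall_isCompact fun K hK => ?_
  by_cases hp : p = 1
  · filter_upwards [ENNReal.ae_le_essSup (μ := volume.restrict K)
      (fun x => (ENNReal.ofReal (phi p w x))⁻¹)] with x hx
    have := ENNReal.inv_lt_top.1 (hx.trans_lt (h.reg.2 hp K hK))
    exact ENNReal.ofReal_pos.1 this
  · have hm : AEMeasurable (fun x => ENNReal.ofReal (phi p w x) ^ (-(conjExp p).toReal))
        (volume.restrict K) :=
      (h.aestronglyMeasurable_phi.aemeasurable.ennreal_ofReal.pow_const _).restrict
    filter_upwards [ae_lt_top' hm (h.reg.1 hp K hK).ne] with x hx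
    by_contra hx0
    rw [ENNReal.ofReal_of_nonpos (not_lt.1 hx0),
      ENNReal.zero_rpow_of_neg (neg_lt_zero.2 (h.conjExp_toReal_pos hp))] at hx
    exact lt_irrefl _ hx

theorem w_pos (h : IsRegularWeight p w G) : ∀ᵐ x, 0 < w x := by
  filter_upwards [h.phi_pos, h.phi_rpow] with x h1 h2
  rw [← h2]
  exact Real.rpow_pos_of_pos h1 _

theorem memLp_inv_phi (h : IsRegularWeight p w G) {K : Set (E d)} (hK : IsCompact K) :
    MemLp (fun x => (phi p w x)⁻¹) (conjExp p) (volume.restrict K) := by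
  have hm : AEStronglyMeasurable (fun x => (phi p w x)⁻¹) (volume.restrict K) :=
    h.aestronglyMeasurable_phi.aemeasurable.inv.aestronglyMeasurable.restrict
  refine ⟨hm, ?_⟩
  have he : ∀ᵐ x ∂(volume.restrict K), ‖(phi p w x)⁻¹‖ₑ = (ENNReal.ofReal (phi p w x))⁻¹ := by
    filter_upwards [ae_restrict_of_ae h.phi_pos] with x hx
    rw [enorm_inv hx.ne', Real.enorm_of_nonneg hx.le]
  by_cases hp : p = 1
  · have : conjExp p = ⊤ := by simp [conjExp, hp]
    rw [this, eLpNorm_exponent_top, eLpNormEssSup, essSup_congr_ae he]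
    exact h.reg.2 hp K hK
  · rw [eLpNorm_lt_top_iff_lintegral_rpow_enorm_lt_top
      (zero_lt_one.trans_le h.one_le_conjExp).ne' (h.conjExp_ne_top hp)]
    refine lt_of_eq_of_lt (lintegral_congr_ae ?_) (h.reg.1 hp K hK)
    filter_upwards [he] with x hx
    rw [hx, ENNReal.rpow_neg, ENNReal.inv_rpow]

theorem absolutelyContinuous (w : E d → ℝ) : weightMeasure w ≪ volume :=
  withDensity_absolutelyContinuous _ _

theorem absolutelyContinuous' (h : IsRegularWeight p w G) : volume ≪ weightMeasure w :=
  withDensity_absolutelyContinuous' h.aemeasurable_ofReal (by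
    filter_upwards [h.w_pos] with x hx
    exact (ENNReal.ofReal_pos.2 hx).ne')

/-- `L^p(μ)` norms are `L^p(dx)` norms of the product with `φ`. -/
theorem eLpNorm_eq (h : IsRegularWeight p w G) {F : Type*} [NormedAddCommGroup F] [NormedSpace ℝ F]
    (g : E d → F) : eLpNorm g p (weightMeasure w) =
      eLpNorm (fun x => phi p w x • g x) p volume := by
  rw [eLpNorm_eq_lintegral_rpow_enorm_toReal h.ne_zero h.ne_top,
    eLpNorm_eq_lintegral_rpow_enorm_toReal h.ne_zero h.ne_top, weightMeasure,
    lintegral_withDensity_eq_lintegral_mul_non_measurable₀ _ h.aemeasurable_ofReal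
      (ae_of_all _ fun _ => ENNReal.ofReal_lt_top)]
  congr 1
  refine lintegral_congr_ae ?_
  filter_upwards [h.phi_rpow, h.phi_nonneg] with x h1 h2
  rw [enorm_smul, ENNReal.mul_rpow_of_nonneg _ _ h.toReal_pos.le, Real.enorm_of_nonneg h2,
    ENNReal.ofReal_rpow_of_nonneg h2 h.toReal_pos.le, h1]
  rfl

theorem aestronglyMeasurable (h : IsRegularWeight p w G) {F : Type*} [NormedAddCommGroup F]
    {g : E d → F} (hg : AEStronglyMeasurable g (weightMeasure w)) :
    AEStronglyMeasurable g volume := hg.mono_ac h.absolutelyContinuous'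

theorem memLp_iff (h : IsRegularWeight p w G) {F : Type*} [NormedAddCommGroup F] [NormedSpace ℝ F]
    {g : E d → F} : MemLp g p (weightMeasure w) ↔
      AEStronglyMeasurable g volume ∧ MemLp (fun x => phi p w x • g x) p volume := by
  constructor
  · intro hg
    refine ⟨h.aestronglyMeasurable hg.1, h.aestronglyMeasurable_phi.smul
      (h.aestronglyMeasurable hg.1), ?_⟩
    rw [← h.eLpNorm_eq]
    exact hg.2
  · rintro ⟨h1, h2⟩
    refine ⟨h1.mono_ac (absolutelyContinuous w), ?_⟩
    rw [h.eLpNorm_eq]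
    exact h2.2

/-- Hölder's inequality with (Reg): `L^p(μ)` embeds continuously into `L^1_loc(dx)`. -/
theorem exists_eLpNorm_one_le (h : IsRegularWeight p w G) {K : Set (E d)} (hK : IsCompact K) :
    ∃ C : ℝ≥0∞, C ≠ ⊤ ∧ ∀ {F : Type} [NormedAddCommGroup F] [NormedSpace ℝ F] (g : E d → F),
      AEStronglyMeasurable g volume →
        eLpNorm g 1 (volume.restrict K) ≤ C * eLpNorm g p (weightMeasure w) := by
  refine ⟨_, (h.memLp_inv_phi hK).eLpNorm_ne_top, fun g hg => ?_⟩
  have := h.holder.symm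
  have e : g =ᵐ[volume.restrict K] (fun x => (phi p w x)⁻¹) • fun x => phi p w x • g x := by
    filter_upwards [ae_restrict_of_ae h.phi_pos] with x hx
    simp [smul_smul, hx.ne']
  rw [eLpNorm_congr_ae e, h.eLpNorm_eq]
  refine (eLpNorm_smul_le_mul_eLpNorm (p := conjExp p) (q := p)
    (h.aestronglyMeasurable_phi.smul hg).restrict (h.memLp_inv_phi hK).1).trans ?_
  gcongr
  exact eLpNorm_mono_measure _ Measure.restrict_le_self

theorem locallyIntegrable (h : IsRegularWeight p w G) {F : Type} [NormedAddCommGroup F]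
    [NormedSpace ℝ F] {g : E d → F} (hg : MemLp g p (weightMeasure w)) :
    LocallyIntegrable g volume := by
  rw [locallyIntegrable_iff]
  intro K hK
  obtain ⟨C, hC, hCK⟩ := h.exists_eLpNorm_one_le hK
  have hm := h.aestronglyMeasurable hg.1
  rw [IntegrableOn, ← memLp_one_iff_integrable]
  exact ⟨hm.restrict, (hCK g hm).trans_lt (ENNReal.mul_lt_top hC.lt_top hg.2)⟩

/-- `φ⁻¹ ∇φ` is locally integrable, by Hölder's inequality between (Reg) and (Diff). -/
theorem locallyIntegrable_inv_phi_smul (h : IsRegularWeight p w G) :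
    LocallyIntegrable (fun x => (phi p w x)⁻¹ • G x) volume := by
  rw [locallyIntegrable_iff]
  intro K hK
  have := h.holder.symm
  rw [IntegrableOn, ← memLp_one_iff_integrable]
  exact (h.diff.2.1 K hK).smul (h.memLp_inv_phi hK)

theorem integrableOn_iff (h : IsRegularWeight p w G) {F : Type*} [NormedAddCommGroup F]
    [NormedSpace ℝ F] {g : E d → F} {K : Set (E d)} (hK : MeasurableSet K) :
    IntegrableOn g K (weightMeasure w) ↔ IntegrableOn (fun x => w x • g x) K volume := by
  rw [IntegrableOn, weightMeasure, restrict_withDensity hK,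
    integrable_withDensity_iff_integrable_smul₀' h.aemeasurable_ofReal.restrict
      (ae_of_all _ fun _ => ENNReal.ofReal_lt_top)]
  refine integrable_congr (ae_restrict_of_ae ?_)
  filter_upwards [h.nonneg] with x hx
  rw [ENNReal.toReal_ofReal hx]

theorem locallyIntegrable_iff_smul (h : IsRegularWeight p w G) {F : Type*} [NormedAddCommGroup F]
    [NormedSpace ℝ F] {g : E d → F} :
    LocallyIntegrable g (weightMeasure w) ↔ LocallyIntegrable (fun x => w x • g x) volume := by
  rw [locallyIntegrable_iff, locallyIntegrable_iff]
  exact forall_congr' fun K => forall_congr' fun hK => h.integrableOn_iff hK.measurableSet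

theorem integral_eq (h : IsRegularWeight p w G) {F : Type*} [NormedAddCommGroup F]
    [NormedSpace ℝ F] (g : E d → F) :
    ∫ x, g x ∂(weightMeasure w) = ∫ x, w x • g x := by
  rw [weightMeasure, integral_withDensity_eq_integral_toReal_smul₀ h.aemeasurable_ofReal
    (ae_of_all _ fun _ => ENNReal.ofReal_lt_top)]
  refine integral_congr_ae ?_
  filter_upwards [h.nonneg] with x hx
  rw [ENNReal.toReal_ofReal hx]

theorem isLocallyFiniteMeasure (h : IsRegularWeight p w G) :
    IsLocallyFiniteMeasure (weightMeasure w) := by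
  have h1 : LocallyIntegrable (fun _ : E d => (1 : ℝ)) (weightMeasure w) := by
    rw [h.locallyIntegrable_iff_smul]
    simpa using h.locInt
  refine ⟨fun x => ?_⟩
  obtain ⟨s, hs, hi⟩ := h1 x
  refine ⟨s, hs, ?_⟩
  simpa [IntegrableOn, integrable_const_iff, isFiniteMeasure_iff] using hi

theorem locallyIntegrable_smul (h : IsRegularWeight p w G) {F : Type*} [NormedAddCommGroup F]
    [NormedSpace ℝ F] {g : E d → F} (hg : MemLp g p (weightMeasure w)) :
    LocallyIntegrable (fun x => w x • g x) volume := by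
  have := h.isLocallyFiniteMeasure
  exact h.locallyIntegrable_iff_smul.1 (hg.locallyIntegrable h.one_le)

theorem locallyIntegrable_w_smul_logDeriv (h : IsRegularWeight p w G) :
    LocallyIntegrable (fun x => w x • logDeriv p w G x) volume := by
  have := h.isLocallyFiniteMeasure
  rw [← h.locallyIntegrable_iff_smul, locallyIntegrable_iff]
  intro K hK
  have : IsFiniteMeasure ((weightMeasure w).restrict K) := ⟨by simpa using hK.measure_lt_top⟩
  exact (h.diff.2.2.2 K hK).integrable h.one_le_conjExp

theorem locallyIntegrable_mul_smul_logDeriv (h : IsRegularWeight p w G) {f : E d → ℝ}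
    (hf : MemLp f p (weightMeasure w)) :
    LocallyIntegrable (fun x => (w x * f x) • logDeriv p w G x) volume := by
  have := h.holder
  simp_rw [mul_smul]
  rw [← h.locallyIntegrable_iff_smul (g := fun x => f x • logDeriv p w G x), locallyIntegrable_iff]
  intro K hK
  rw [IntegrableOn, ← memLp_one_iff_integrable]
  exact (h.diff.2.2.2 K hK).smul (hf.restrict K)

end IsRegularWeight

end Weight

/-! ### Equality of `V` and `W` -/

section VW

variable {d : ℕ} {p : ℝ≥0∞} {w : E d → ℝ} {G : E d → E d}

/-- The chain rule for a function of one weakly differentiable function. -/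
theorem HasWeakGradient.comp {u : E d → ℝ} {U : E d → E d} {F F' : ℝ → ℝ} {C : ℝ}
    (hu : HasWeakGradient u U) (hF : ∀ t, HasDerivAt F (F' t) t) (hF' : Continuous F')
    (hC : ∀ t, |F' t| ≤ C) :
    HasWeakGradient (fun x => F (u x)) (fun x => F' (u x) • U x) := by
  have hb : HasBddPartials (fun z => F z.1) (fun z => F' z.1) (fun _ => 0) C := by
    refine ⟨fun z => ?_, by fun_prop, continuous_const, fun z => hC _, fun z => ?_⟩
    · refine ((hF z.1).comp_hasFDerivAt z
        (ContinuousLinearMap.fst ℝ ℝ ℝ).hasFDerivAt).congr_fderiv ?_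
      simp
    · simpa using (abs_nonneg _).trans (hC 0)
  simpa using hb.hasWeakGradient hu hu

theorem hasDerivAt_abs_rpow_sinTrunc {q : ℝ} (hq : 1 < q) (n : ℕ) (t : ℝ) :
    HasDerivAt (fun t => |sinTrunc n t| ^ q)
      (q * |sinTrunc n t| ^ (q - 2) * sinTrunc n t * Real.cos (t / ((n : ℝ) + 1))) t :=
  (hasDerivAt_abs_rpow (sinTrunc n t) hq).comp t (hasDerivAt_sinTrunc n t)

theorem abs_mul_rpow_mul_eq {q : ℝ} (hq : 1 < q) (s : ℝ) :
    |q * |s| ^ (q - 2) * s| = q * |s| ^ (q - 1) := by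
  rw [abs_mul, abs_mul, abs_of_pos (by linarith : 0 < q),
    abs_of_nonneg (Real.rpow_nonneg (abs_nonneg s) _), mul_assoc]
  rcases eq_or_ne s 0 with rfl | hs
  · simp [Real.zero_rpow (by linarith : q - 1 ≠ 0)]
  · congr 1
    rw [← Real.rpow_add_one (abs_pos.2 hs).ne']
    congr 1
    ring

theorem continuous_mul_rpow_mul {q : ℝ} (hq : 1 < q) :
    Continuous fun s : ℝ => q * |s| ^ (q - 2) * s := by
  have h1 : Continuous (deriv fun s : ℝ => ‖s‖ ^ q) :=
    (contDiff_norm_rpow hq).continuous_deriv le_rfl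
  convert h1 using 1
  funext s
  exact (hasDerivAt_abs_rpow s hq).deriv.symm

namespace IsRegularWeight

/-- The weight `w = φ^p` is weakly differentiable with gradient `w β = p φ^{p-1} ∇φ`. -/
theorem hasWeakGradient_w (h : IsRegularWeight p w G) :
    HasWeakGradient w (fun x => w x • logDeriv p w G x) := by
  have hw0 : ∀ᵐ x, 0 < phi p w x ∧ phi p w x ^ p.toReal = w x := by
    filter_upwards [h.phi_pos, h.phi_rpow] with x h1 h2 using ⟨h1, h2⟩
  have hβ : ∀ᵐ x, w x • logDeriv p w G x =
      (p.toReal * phi p w x ^ (p.toReal - 1)) • G x := by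
    filter_upwards [hw0] with x ⟨h1, h2⟩
    rw [logDeriv, smul_smul, ← h2, Real.rpow_sub_one h1.ne']
    congr 1
    field_simp
  -- for `p = 1` the weight is `φ` itself; `|·|^p` is continuously differentiable only for `p > 1`
  rcases h.one_le_toReal.eq_or_lt with h1 | h1
  · refine h.hasWeakGradient_phi.congr_ae ?_ ?_
    · filter_upwards [hw0] with x hx
      rw [← hx.2, ← h1, Real.rpow_one]
    · filter_upwards [hβ] with x hx
      rw [hx, ← h1]
      simp
  set q := p.toReal with hq
  refine hasWeakGradient_of_tendsto
    (u' := fun n x => |sinTrunc n (phi p w x)| ^ q)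
    (U' := fun n x => (q * |sinTrunc n (phi p w x)| ^ (q - 2) * sinTrunc n (phi p w x) *
      Real.cos (phi p w x / ((n : ℝ) + 1))) • G x)
    (fun n => h.hasWeakGradient_phi.comp (C := q * ((n : ℝ) + 1) ^ (q - 1))
      (hasDerivAt_abs_rpow_sinTrunc h1 n) ?_ fun t => ?_) h.locInt
    (locallyIntegrable_norm h.locallyIntegrable_w_smul_logDeriv) (fun n => ?_) (fun n => ?_) ?_ ?_
  · have hs := continuous_sinTrunc n
    have h2 := (continuous_mul_rpow_mul h1).comp hs
    exact h2.mul (by fun_prop)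
  · rw [abs_mul, abs_mul_rpow_mul_eq h1]
    calc _ ≤ q * |sinTrunc n t| ^ (q - 1) * 1 := by
          gcongr
          exact Real.abs_cos_le_one _
      _ ≤ _ := by
          rw [mul_one]
          gcongr
          exact abs_sinTrunc_le_nat n t
  · filter_upwards [hw0] with x ⟨h2, h3⟩
    rw [Real.norm_of_nonneg (by positivity), ← h3]
    gcongr
    exact (abs_sinTrunc_le n _).trans_eq (abs_of_pos h2)
  · filter_upwards [hw0, hβ] with x ⟨h2, h3⟩ h4
    rw [h4, norm_smul, norm_smul, Real.norm_eq_abs, abs_mul, abs_mul_rpow_mul_eq h1]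
    gcongr
    rw [Real.norm_of_nonneg (by positivity)]
    calc _ ≤ q * |sinTrunc n (phi p w x)| ^ (q - 1) * 1 := by
          gcongr
          exact Real.abs_cos_le_one _
      _ ≤ _ := by
          rw [mul_one]
          gcongr
          exact (abs_sinTrunc_le n _).trans_eq (abs_of_pos h2)
  · filter_upwards [hw0] with x ⟨h2, h3⟩
    have := ((tendsto_sinTrunc (phi p w x)).abs).rpow_const (p := q) (Or.inr (by linarith))
    rwa [abs_of_pos h2, h3] at this
  · filter_upwards [hw0, hβ] with x ⟨h2, h3⟩ h4
    have t1 := ((continuous_mul_rpow_mul h1).tendsto (phi p w x)).comp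
      (tendsto_sinTrunc (phi p w x))
    have t2 := (t1.mul (tendsto_cos_div (phi p w x))).smul_const (G x)
    have e : (q * |phi p w x| ^ (q - 2) * phi p w x * 1) • G x = w x • logDeriv p w G x := by
      rw [h4, mul_one, abs_of_pos h2, mul_assoc, ← Real.rpow_add_one h2.ne']
      congr 3
      ring
    rwa [e] at t2

/-- Membership in `V` says that `w f` is weakly differentiable in the classical sense, with the
gradient that the product rule predicts. -/
theorem isGradV_iff (h : IsRegularWeight p w G) (f : Lp ℝ p (weightMeasure w))
    (v : Lp (E d) p (weightMeasure w)) : IsGradV p w G f v ↔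
      HasWeakGradient (fun x => w x * f x)
        (fun x => w x • v x + (w x * f x) • logDeriv p w G x) := by
  have l1 : LocallyIntegrable (fun x => w x * f x) volume := h.locallyIntegrable_smul (Lp.memLp f)
  have l2 := h.locallyIntegrable_smul (Lp.memLp v)
  have l3 := h.locallyIntegrable_mul_smul_logDeriv (Lp.memLp f)
  have l4 : LocallyIntegrable (fun x => w x • v x + (w x * f x) • logDeriv p w G x) volume :=
    l2.add l3
  rw [HasWeakGradient, and_iff_right l1, and_iff_right l4, IsGradV]
  refine forall_congr' fun η => forall_congr' fun hη => forall_congr' fun i => ?_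
  have i2 := (EuclideanSpace.proj i : E d →L[ℝ] ℝ).integrable_comp (hη.integrable_smul l2)
  have i3 := (EuclideanSpace.proj i : E d →L[ℝ] ℝ).integrable_comp (hη.integrable_smul l3)
  simp only [map_smul, smul_eq_mul, PiLp.proj_apply] at i2 i3
  have e1 : ∫ x, f x * (gradient η x) i ∂(weightMeasure w) =
      ∫ x, w x * f x * (gradient η x) i := by
    rw [h.integral_eq]
    simp [mul_assoc]
  have e2 : ∫ x, (w x • v x + (w x * f x) • logDeriv p w G x) i * η x =
      (∫ x, (v x) i * η x ∂(weightMeasure w)) +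
        ∫ x, f x * η x * (logDeriv p w G x) i ∂(weightMeasure w) := by
    rw [h.integral_eq, h.integral_eq, ← integral_add]
    · refine integral_congr_ae (ae_of_all _ fun x => ?_)
      simp only [PiLp.add_apply, PiLp.smul_apply, smul_eq_mul]
      ring
    · refine i2.congr (ae_of_all _ fun x => ?_)
      simp only [smul_eq_mul]
      ring
    · refine i3.congr (ae_of_all _ fun x => ?_)
      simp only [smul_eq_mul]
      ring
  rw [e1, e2]
  constructor <;> intro h' <;> linarith

theorem isGradV_of_isGradW (h : IsRegularWeight p w G) {f : Lp ℝ p (weightMeasure w)}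
    {v : Lp (E d) p (weightMeasure w)} (hW : IsGradW p w f v) : IsGradV p w G f v := by
  rw [h.isGradV_iff]
  have h1 := h.locallyIntegrable_smul (Lp.memLp f)
  have h2 := h.locallyIntegrable_smul (Lp.memLp v)
  have h3 := h.locallyIntegrable_mul_smul_logDeriv (Lp.memLp f)
  have e : ∀ x, f x • w x • logDeriv p w G x = (w x * f x) • logDeriv p w G x := by
    intro x; rw [smul_smul, mul_comm]
  simpa only [e] using h.hasWeakGradient_w.mul hW h1 h2 (by simpa only [e] using h3)

end IsRegularWeight

/-- The derivative of `t ↦ (m + 1) arctan (t / (m + 1))`. -/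
noncomputable def arctanDeriv (m : ℕ) (t : ℝ) : ℝ := (1 + (t / ((m : ℝ) + 1)) ^ 2)⁻¹

/-- A bounded approximation `T` of the identity of the line for which also `t ↦ t T'(t)` is
bounded. -/
noncomputable def arctanTrunc (m : ℕ) (t : ℝ) : ℝ := ((m : ℝ) + 1) * Real.arctan (t / ((m : ℝ) + 1))

theorem hasDerivAt_arctanTrunc (m : ℕ) (t : ℝ) :
    HasDerivAt (arctanTrunc m) (arctanDeriv m t) t := by
  have h0 : (m : ℝ) + 1 ≠ 0 := m.cast_add_one_ne_zero
  have := (((hasDerivAt_id t).div_const ((m : ℝ) + 1)).arctan).const_mul ((m : ℝ) + 1)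
  refine this.congr_deriv ?_
  simp only [id, arctanDeriv]
  field_simp

theorem continuous_arctanTrunc (m : ℕ) : Continuous (arctanTrunc m) :=
  continuous_iff_continuousAt.2 fun t => (hasDerivAt_arctanTrunc m t).continuousAt

theorem continuous_arctanDeriv (m : ℕ) : Continuous (arctanDeriv m) := by
  unfold arctanDeriv
  refine Continuous.inv₀ (by fun_prop) fun t => ?_
  positivity

theorem arctanDeriv_nonneg (m : ℕ) (t : ℝ) : 0 ≤ arctanDeriv m t := by
  unfold arctanDeriv; positivity

theorem arctanDeriv_le_one (m : ℕ) (t : ℝ) : arctanDeriv m t ≤ 1 :=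
  inv_le_one_of_one_le₀ (by linarith [sq_nonneg (t / ((m : ℝ) + 1))])

theorem abs_arctanDeriv_le (m : ℕ) (t : ℝ) : |arctanDeriv m t| ≤ 1 := by
  rw [abs_of_nonneg (arctanDeriv_nonneg m t)]
  exact arctanDeriv_le_one m t

theorem abs_arctanDeriv_mul_le (m : ℕ) (t : ℝ) : |arctanDeriv m t * t| ≤ (m : ℝ) + 1 := by
  have h0 : (0 : ℝ) < (m : ℝ) + 1 := m.cast_add_one_pos
  set s := t / ((m : ℝ) + 1) with hs
  have ht : t = ((m : ℝ) + 1) * s := by rw [hs]; field_simp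
  have h1 : |(1 + s ^ 2)⁻¹ * s| ≤ 1 := by
    have h2 : (0 : ℝ) < 1 + s ^ 2 := by positivity
    rw [abs_mul, abs_of_pos (inv_pos.2 h2), inv_mul_le_iff₀ h2, mul_one]
    nlinarith [sq_nonneg (|s| - 1), sq_abs s]
  rw [arctanDeriv, ← hs, ht, mul_left_comm, abs_mul, abs_of_pos h0]
  exact mul_le_of_le_one_right h0.le h1

theorem abs_arctanTrunc_le (m : ℕ) (t : ℝ) : |arctanTrunc m t| ≤ |t| := by
  have := convex_univ.norm_image_sub_le_of_norm_hasDerivWithin_le (f := arctanTrunc m) (C := 1)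
    (x := 0) (y := t) (fun t _ => (hasDerivAt_arctanTrunc m t).hasDerivWithinAt)
    (fun t _ => abs_arctanDeriv_le m t) (mem_univ _) (mem_univ _)
  simpa [arctanTrunc] using this

theorem abs_arctanTrunc_le_nat (m : ℕ) (t : ℝ) : |arctanTrunc m t| ≤ ((m : ℝ) + 1) * 2 := by
  have h0 : (0 : ℝ) < (m : ℝ) + 1 := m.cast_add_one_pos
  rw [arctanTrunc, abs_mul, abs_of_pos h0]
  gcongr
  rw [abs_le]
  constructor <;> linarith [Real.neg_pi_div_two_lt_arctan (t / ((m : ℝ) + 1)),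
    Real.arctan_lt_pi_div_two (t / ((m : ℝ) + 1)), Real.pi_le_four]

theorem tendsto_arctanDeriv (t : ℝ) : Tendsto (fun m => arctanDeriv m t) atTop (𝓝 1) := by
  have h1 : Tendsto (fun n : ℕ => t / ((n : ℝ) + 1)) atTop (𝓝 0) := by
    have := (tendsto_one_div_add_atTop_nhds_zero_nat (𝕜 := ℝ)).const_mul t
    simpa [div_eq_mul_inv] using this
  have := ((h1.pow 2).const_add 1).inv₀ (by norm_num)
  simpa [arctanDeriv] using this

theorem tendsto_arctanTrunc (t : ℝ) : Tendsto (fun m => arctanTrunc m t) atTop (𝓝 t) := by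
  have h1 : Tendsto (fun n : ℕ => t / ((n : ℝ) + 1)) atTop (𝓝 0) := by
    have := (tendsto_one_div_add_atTop_nhds_zero_nat (𝕜 := ℝ)).const_mul t
    simpa [div_eq_mul_inv] using this
  rcases eq_or_ne t 0 with rfl | ht
  · simp [arctanTrunc]
  have h2 : HasDerivAt Real.arctan 1 0 := by simpa using Real.hasDerivAt_arctan 0
  have h3 := h2.tendsto_slope.comp (tendsto_nhdsWithin_iff.2 ⟨h1, Eventually.of_forall fun n =>
    (div_ne_zero ht (Nat.cast_add_one_ne_zero n) : t / ((n : ℝ) + 1) ≠ 0)⟩)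
  have h4 := h3.const_mul t
  rw [mul_one] at h4
  refine h4.congr fun n => ?_
  have h0 : (n : ℝ) + 1 ≠ 0 := n.cast_add_one_ne_zero
  simp only [Function.comp, slope, arctanTrunc, sub_zero, vsub_eq_sub, smul_eq_mul,
    Real.arctan_zero]
  field_simp

/-- The function `F(a, b) = T(a (b² + ε²)^{-q/2})`, which recovers a truncation of `f` from `w f`
and `φ` as `ε → 0`. -/
theorem hasBddPartials_arctanTrunc (m : ℕ) {q ε : ℝ} (hq : 0 ≤ q) (hε : 0 < ε) :
    HasBddPartials (fun z => arctanTrunc m (z.1 * (z.2 ^ 2 + ε ^ 2) ^ (-q / 2)))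
      (fun z => arctanDeriv m (z.1 * (z.2 ^ 2 + ε ^ 2) ^ (-q / 2)) *
        (z.2 ^ 2 + ε ^ 2) ^ (-q / 2))
      (fun z => arctanDeriv m (z.1 * (z.2 ^ 2 + ε ^ 2) ^ (-q / 2)) *
        (z.1 * (z.2 ^ 2 + ε ^ 2) ^ (-q / 2)) * (-(q * (z.2 / (z.2 ^ 2 + ε ^ 2)))))
      ((ε ^ 2) ^ (-q / 2) + ((m : ℝ) + 1) * (q * ε⁻¹)) := by
  have hpos : ∀ b : ℝ, 0 < b ^ 2 + ε ^ 2 := fun b => by positivity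
  have hr : ∀ b : ℝ, HasDerivAt (fun b : ℝ => (b ^ 2 + ε ^ 2) ^ (-q / 2))
      ((b ^ 2 + ε ^ 2) ^ (-q / 2) * (-(q * (b / (b ^ 2 + ε ^ 2))))) b := by
    intro b
    have h1 : HasDerivAt (fun b : ℝ => b ^ 2 + ε ^ 2) (2 * b) b := by
      simpa using (hasDerivAt_pow 2 b).add_const (ε ^ 2)
    refine (h1.rpow_const (p := -q / 2) (Or.inl (hpos b).ne')).congr_deriv ?_
    rw [Real.rpow_sub_one (hpos b).ne']
    have := (hpos b).ne'
    field_simp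
  have hrc : Continuous fun z : ℝ × ℝ => (z.2 ^ 2 + ε ^ 2) ^ (-q / 2) :=
    Continuous.rpow_const (by fun_prop) fun z => Or.inl (hpos z.2).ne'
  have hDc : Continuous fun z : ℝ × ℝ => arctanDeriv m (z.1 * (z.2 ^ 2 + ε ^ 2) ^ (-q / 2)) :=
    (continuous_arctanDeriv m).comp (continuous_fst.mul hrc)
  have h0 : (0 : ℝ) < (m : ℝ) + 1 := m.cast_add_one_pos
  have hA : 0 ≤ (ε ^ 2) ^ (-q / 2) := by positivity
  have hB : 0 ≤ ((m : ℝ) + 1) * (q * ε⁻¹) := by positivity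
  refine ⟨fun z => ?_, hDc.mul hrc, ?_, fun z => ?_, fun z => ?_⟩
  · have e1 : HasFDerivAt (fun z : ℝ × ℝ => (z.2 ^ 2 + ε ^ 2) ^ (-q / 2)) _ z :=
      (hr z.2).comp_hasFDerivAt z (ContinuousLinearMap.snd ℝ ℝ ℝ).hasFDerivAt
    have e2 := (ContinuousLinearMap.fst ℝ ℝ ℝ).hasFDerivAt (x := z) |>.mul e1
    have e3 := (hasDerivAt_arctanTrunc m (z.1 * (z.2 ^ 2 + ε ^ 2) ^ (-q / 2))).comp_hasFDerivAt z e2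
    refine e3.congr_fderiv ?_
    ext <;> simp [mul_assoc]
  · refine (hDc.mul (continuous_fst.mul hrc)).mul ?_
    refine (continuous_const.mul (continuous_snd.div (by fun_prop) fun z => (hpos z.2).ne')).neg
  · rw [abs_mul]
    have h1 : |(z.2 ^ 2 + ε ^ 2) ^ (-q / 2)| ≤ (ε ^ 2) ^ (-q / 2) := by
      rw [abs_of_nonneg (Real.rpow_nonneg (hpos _).le _)]
      exact Real.rpow_le_rpow_of_nonpos (by positivity) (by nlinarith [sq_nonneg z.2]) (by linarith)
    calc _ ≤ 1 * (ε ^ 2) ^ (-q / 2) := by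
          gcongr
          exact abs_arctanDeriv_le _ _
      _ ≤ _ := by linarith
  · rw [abs_mul]
    have h1 : |(-(q * (z.2 / (z.2 ^ 2 + ε ^ 2))))| ≤ q * ε⁻¹ := by
      rw [abs_neg, abs_mul, abs_of_nonneg hq, abs_div, abs_of_pos (hpos _)]
      gcongr
      rw [div_le_iff₀ (hpos _), inv_mul_eq_div, le_div_iff₀ hε]
      nlinarith [sq_nonneg (|z.2| - ε), sq_abs z.2]
    calc _ ≤ ((m : ℝ) + 1) * (q * ε⁻¹) := by
          gcongr
          exact abs_arctanDeriv_mul_le _ _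
      _ ≤ _ := by linarith

namespace IsRegularWeight

/-- Dividing by the weight: if `w f` has the weak gradient that the product rule predicts, then the
truncations of `f` are weakly differentiable. The bound on `t T'(t)` reduces the error term to
`φ⁻¹ ∇φ`, which is locally integrable. -/
theorem hasWeakGradient_arctanTrunc (h : IsRegularWeight p w G) {f : E d → ℝ} {v : E d → E d}
    (hv : LocallyIntegrable v volume)
    (hV : HasWeakGradient (fun x => w x * f x)
      (fun x => w x • v x + (w x * f x) • logDeriv p w G x)) (m : ℕ) :
    HasWeakGradient (fun x => arctanTrunc m (f x)) (fun x => arctanDeriv m (f x) • v x) := by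
  set q := p.toReal with hq
  have hq0 : 0 < q := h.toReal_pos
  have hF := fun n : ℕ => (hasBddPartials_arctanTrunc m hq0.le
    (Nat.one_div_pos_of_nat (α := ℝ) (n := n))).hasWeakGradient hV h.hasWeakGradient_phi
  have hB : LocallyIntegrable (fun x => ‖v x‖ + ((m : ℝ) + 1) * q * ‖(phi p w x)⁻¹ • G x‖)
      volume := (locallyIntegrable_norm hv).add
    ((locallyIntegrable_norm h.locallyIntegrable_inv_phi_smul).smul (((m : ℝ) + 1) * q))
  -- the gradient of the approximation, with `r = (φ² + ε²)^{-q/2}`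
  have key : ∀ x, 0 < phi p w x → ∀ r s ε : ℝ,
      (arctanDeriv m s * r) • (w x • v x + (w x * f x) • logDeriv p w G x) +
        (arctanDeriv m s * (w x * f x * r) * (-(q * (phi p w x / (phi p w x ^ 2 + ε ^ 2))))) • G x =
      (arctanDeriv m s * (w x * r)) • v x + (arctanDeriv m s * (w x * f x * r) * q *
        (1 - phi p w x ^ 2 / (phi p w x ^ 2 + ε ^ 2))) • (phi p w x)⁻¹ • G x := by
    intro x hx r s ε
    have e1 : phi p w x / (phi p w x ^ 2 + ε ^ 2) =
        phi p w x ^ 2 / (phi p w x ^ 2 + ε ^ 2) * (phi p w x)⁻¹ := by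
      field_simp
    rw [e1, logDeriv]
    module
  have hw : ∀ᵐ x, 0 < phi p w x ∧ phi p w x ^ q = w x := by
    filter_upwards [h.phi_pos, h.phi_rpow] with x h1 h2 using ⟨h1, h2⟩
  have hrw : ∀ t : ℝ, 0 < t → (t ^ 2) ^ (-q / 2) * t ^ q = 1 := by
    intro t ht
    rw [← Real.rpow_natCast, ← Real.rpow_mul ht.le, ← Real.rpow_add ht]
    norm_num
    rw [show 2 * (-q / 2) + q = 0 by ring, Real.rpow_zero]
  refine hasWeakGradient_of_tendsto hF (locallyIntegrable_const (((m : ℝ) + 1) * 2)) hB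
    (fun n => ae_of_all _ fun x => abs_arctanTrunc_le_nat _ _) (fun n => ?_) ?_ ?_
  · filter_upwards [hw] with x ⟨h1, h2⟩
    rw [key x h1]
    set ε : ℝ := 1 / ((n : ℝ) + 1) with hε
    have hpos : 0 < phi p w x ^ 2 + ε ^ 2 := by positivity
    set r := (phi p w x ^ 2 + ε ^ 2) ^ (-q / 2) with hr
    have hr0 : 0 ≤ r := Real.rpow_nonneg hpos.le _
    have hwr : w x * r ≤ 1 := by
      have h3 : r ≤ (phi p w x ^ 2) ^ (-q / 2) :=
        Real.rpow_le_rpow_of_nonpos (by positivity) (by nlinarith [sq_nonneg ε]) (by linarith)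
      rw [← hrw _ h1, h2, mul_comm]
      gcongr
      rw [← h2]; positivity
    have hw0 : 0 ≤ w x := by rw [← h2]; positivity
    have hle : phi p w x ^ 2 / (phi p w x ^ 2 + ε ^ 2) ≤ 1 :=
      (div_le_one hpos).2 (by nlinarith [sq_nonneg ε])
    have hge : 0 ≤ phi p w x ^ 2 / (phi p w x ^ 2 + ε ^ 2) := by positivity
    refine (norm_add_le _ _).trans (add_le_add ?_ ?_)
    · rw [norm_smul, Real.norm_eq_abs, abs_mul, abs_of_nonneg (mul_nonneg hw0 hr0)]
      refine mul_le_of_le_one_left (norm_nonneg _) ?_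
      exact mul_le_one₀ (abs_arctanDeriv_le _ _) (mul_nonneg hw0 hr0) hwr
    · rw [norm_smul _ ((phi p w x)⁻¹ • G x), Real.norm_eq_abs, abs_mul, abs_mul _ q,
        abs_of_pos hq0]
      have h3 : |1 - phi p w x ^ 2 / (phi p w x ^ 2 + ε ^ 2)| ≤ 1 := by
        rw [abs_le]; constructor <;> linarith
      refine mul_le_mul_of_nonneg_right ?_ (norm_nonneg _)
      refine (mul_le_of_le_one_right (by positivity) h3).trans ?_
      exact mul_le_mul_of_nonneg_right (abs_arctanDeriv_mul_le _ _) hq0.le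
  all_goals
    have hε2 : ∀ b : ℝ, Tendsto (fun n : ℕ => b ^ 2 + (1 / ((n : ℝ) + 1)) ^ 2) atTop
        (𝓝 (b ^ 2)) := fun b => by
      simpa using ((tendsto_one_div_add_atTop_nhds_zero_nat (𝕜 := ℝ)).pow 2).const_add (b ^ 2)
    have hs : ∀ x, 0 < phi p w x → Tendsto (fun n : ℕ =>
        (phi p w x ^ 2 + (1 / ((n : ℝ) + 1)) ^ 2) ^ (-q / 2)) atTop
          (𝓝 ((phi p w x ^ 2) ^ (-q / 2))) := fun x hx =>
      (hε2 _).rpow_const (Or.inl (by positivity))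
    filter_upwards [hw] with x ⟨h1, h2⟩
    have e : w x * f x * (phi p w x ^ 2) ^ (-q / 2) = f x := by
      rw [← h2, mul_right_comm, mul_comm (_ ^ q), hrw _ h1, one_mul]
    have t1 := (hs x h1).const_mul (w x * f x)
    rw [e] at t1
  · exact ((continuous_arctanTrunc m).tendsto _).comp t1
  · simp_rw [key x h1]
    have t2 := (hs x h1).const_mul (w x)
    rw [← h2, mul_comm (_ ^ q), hrw _ h1, h2] at t2
    have t3 := ((continuous_arctanDeriv m).tendsto _).comp t1
    have hne : phi p w x ^ 2 ≠ 0 := by positivity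
    have t4 : Tendsto (fun n : ℕ => 1 - phi p w x ^ 2 /
        (phi p w x ^ 2 + (1 / ((n : ℝ) + 1)) ^ 2)) atTop (𝓝 0) := by
      have := (((tendsto_const_nhds (x := phi p w x ^ 2)).div (hε2 (phi p w x)) hne).const_sub 1)
      rwa [div_self hne, sub_self] at this
    have := ((t3.mul t2).smul_const (v x)).add
      ((((t3.mul t1).mul_const q).mul t4).smul_const ((phi p w x)⁻¹ • G x))
    simpa using this

theorem isGradW_of_isGradV (h : IsRegularWeight p w G) {f : Lp ℝ p (weightMeasure w)}
    {v : Lp (E d) p (weightMeasure w)} (hV : IsGradV p w G f v) : IsGradW p w f v := by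
  rw [h.isGradV_iff] at hV
  have lf := h.locallyIntegrable (Lp.memLp f)
  have lv := h.locallyIntegrable (Lp.memLp v)
  refine hasWeakGradient_of_tendsto (h.hasWeakGradient_arctanTrunc lv hV)
    (locallyIntegrable_norm lf) (locallyIntegrable_norm lv)
    (fun m => ae_of_all _ fun x => abs_arctanTrunc_le _ _) (fun m => ae_of_all _ fun x => ?_)
    (ae_of_all _ fun x => tendsto_arctanTrunc _) (ae_of_all _ fun x => ?_)
  · rw [norm_smul]
    exact mul_le_of_le_one_left (norm_nonneg _) (abs_arctanDeriv_le _ _)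
  · simpa using (tendsto_arctanDeriv (f x)).smul_const (v x)

end IsRegularWeight

end VW

/-! ### Density of test functions -/

section Density

variable {d : ℕ} {p : ℝ≥0∞} {w : E d → ℝ} {G : E d → E d}

theorem memLp_of_locMemLp {F : Type*} [NormedAddCommGroup F] {g : E d → F} {r : ℝ≥0∞}
    (hg : LocMemLp g r volume) {K : Set (E d)} (hK : IsCompact K) (h0 : ∀ x ∉ K, g x = 0) :
    MemLp g r volume := by
  have h1 := (memLp_indicator_iff_restrict hK.measurableSet).2 (hg K hK)
  rwa [indicator_eq_self.2 fun x hx => by_contra fun h => hx (h0 x h)] at h1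

theorem LocMemLp.continuous_smul {F : Type*} [NormedAddCommGroup F] [NormedSpace ℝ F]
    {g : E d → F} {r : ℝ≥0∞} (hg : LocMemLp g r volume) {c : E d → ℝ} (hc : Continuous c) :
    LocMemLp (fun x => c x • g x) r volume := by
  intro K hK
  obtain ⟨M, hM⟩ := hK.exists_bound_of_continuousOn hc.continuousOn
  refine (hg K hK).of_le_mul (c := M) (hc.aestronglyMeasurable.smul (hg K hK).1) ?_
  filter_upwards [ae_restrict_mem hK.measurableSet] with x hx
  rw [norm_smul]
  gcongr
  exact hM x hx

theorem LocMemLp.smul_continuous {F : Type*} [NormedAddCommGroup F] [NormedSpace ℝ F]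
    {g : E d → ℝ} {r : ℝ≥0∞} (hg : LocMemLp g r volume) {c : E d → F} (hc : Continuous c) :
    LocMemLp (fun x => g x • c x) r volume := by
  intro K hK
  obtain ⟨M, hM⟩ := hK.exists_bound_of_continuousOn hc.continuousOn
  refine (hg K hK).of_le_mul (c := M) ((hg K hK).1.smul hc.aestronglyMeasurable) ?_
  filter_upwards [ae_restrict_mem hK.measurableSet] with x hx
  rw [norm_smul, mul_comm]
  gcongr
  exact hM x hx

theorem norm_mollify_le {f : E d → ℝ} {M : ℝ} (hM : ∀ x, |f x| ≤ M) (n : ℕ) (x : E d) :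
    ‖mollify n f x‖ ≤ M := by
  have hM0 : 0 ≤ M := (abs_nonneg _).trans (hM 0)
  have h1 : ‖mollify n f x‖ₑ ≤ ENNReal.ofReal M := by
    refine (enorm_mollify_le n f x).trans ?_
    calc _ ≤ ∫⁻ _ : E d, ENNReal.ofReal M ∂(volume.withDensity fun z => ‖moll d n z‖ₑ) := by
          refine lintegral_mono fun z => ?_
          rw [← ofReal_norm]
          exact ENNReal.ofReal_le_ofReal (hM _)
      _ = _ := by
          rw [lintegral_const, withDensity_apply _ MeasurableSet.univ, Measure.restrict_univ,
            lintegral_moll, mul_one]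
  rw [← ofReal_norm] at h1
  exact (ENNReal.ofReal_le_ofReal_iff hM0).1 h1

namespace IsRegularWeight

/-- Mollifications of a bounded, compactly supported element of `W` converge to it. -/
theorem tendsto_mollify (h : IsRegularWeight p w G) {f : E d → ℝ} {v : E d → E d} {M R : ℝ}
    (hv : MemLp v p (weightMeasure w)) (hfv : HasWeakGradient f v) (hM : ∀ x, |f x| ≤ M)
    (hfR : ∀ x, R < ‖x‖ → f x = 0) (hvR : ∀ x, R < ‖x‖ → v x = 0) :
    Tendsto (fun n => eLpNorm (mollify n f - f) p (weightMeasure w)) atTop (𝓝 0) ∧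
      Tendsto (fun n => eLpNorm (gradient (mollify n f) - v) p (weightMeasure w)) atTop (𝓝 0) := by
  -- cut off `φ` away from the supports of all functions involved
  obtain ⟨N, hN⟩ := exists_nat_gt (R + 2)
  set χ := cutoff d N with hχ
  have hχt : IsTestFunction χ := cutoff_isTestFunction N
  have hχ1 : ∀ x : E d, ‖x‖ ≤ R + 2 → χ x = 1 := fun x hx => cutoff_eq_one (by linarith)
  have hχ0 : ∀ x ∉ tsupport χ, χ x = 0 := fun x hx => image_eq_zero_of_notMem_tsupport hx
  have hφ := h.hasWeakGradient_phi.smooth_mul hχt.1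
  have hφp : MemLp (fun x => χ x * phi p w x) p volume :=
    memLp_of_locMemLp (h.diff.1.continuous_smul hχt.1.continuous) hχt.2 fun x hx => by
      simp [hχ0 x hx]
  have hGp : MemLp (fun x => χ x • G x + phi p w x • gradient χ x) p volume :=
    (memLp_of_locMemLp (h.diff.2.1.continuous_smul hχt.1.continuous) hχt.2 fun x hx => by
      simp [hχ0 x hx]).add
    (memLp_of_locMemLp (h.diff.1.smul_continuous (continuous_gradient hχt.1)) hχt.2 fun x hx => by
      simp [gradient_eq_zero_of_notMem_tsupport hx])
  have hfm := hfv.1.aestronglyMeasurable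
  have hvφ : MemLp (fun x => (χ x * phi p w x) • v x) p volume := by
    have h1 := (h.memLp_iff.1 hv).2
    refine h1.mono (hφp.1.smul hfv.2.1.aestronglyMeasurable) (ae_of_all _ fun x => ?_)
    rw [mul_smul, norm_smul]
    refine mul_le_of_le_one_left (norm_nonneg _) ?_
    rw [Real.norm_of_nonneg (cutoff_nonneg N x)]
    exact cutoff_le_one N x
  have hfφ : MemLp (fun x => f x * (χ x * phi p w x)) p volume :=
    hφp.of_le_mul (c := M) (hfm.mul hφp.1) (ae_of_all _ fun x => by
      rw [norm_mul]
      gcongr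
      exact hM x)
  have hfG : MemLp (fun x => f x • (χ x • G x + phi p w x • gradient χ x)) p volume :=
    hGp.of_le_mul (c := M) (hfm.smul hGp.1) (ae_of_all _ fun x => by
      rw [norm_smul]
      gcongr
      exact hM x)
  have hJ := hfv.mul hφ (hfφ.locallyIntegrable h.one_le) (hfG.locallyIntegrable h.one_le)
    (hvφ.locallyIntegrable h.one_le)
  set K := Metric.closedBall (0 : E d) (R + 2) with hK
  have hKc : IsCompact K := isCompact_closedBall _ _
  have hzero : ∀ (n : ℕ) {F : Type} [NormedAddCommGroup F] [NormedSpace ℝ F] (g : E d → F),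
      (∀ x, R < ‖x‖ → g x = 0) → ∀ x ∉ K, mollify n g x - g x = 0 := by
    intro n F _ _ g hg x hx
    have hx' : R + 2 < ‖x‖ := by simpa [hK] using hx
    rw [mollify_eq_zero hg hx', hg x (by linarith), sub_zero]
  have heq : ∀ (n : ℕ) {F : Type} [NormedAddCommGroup F] [NormedSpace ℝ F] (g : E d → F),
      (∀ x, R < ‖x‖ → g x = 0) → eLpNorm (mollify n g - g) p (weightMeasure w) =
        eLpNorm (fun x => (χ x * phi p w x) • (mollify n g x - g x)) p volume := by
    intro n F _ _ g hg
    rw [h.eLpNorm_eq]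
    congr 1
    funext x
    by_cases hx : x ∈ K
    · rw [hχ1 x (by simpa [hK] using hx), one_mul, Pi.sub_apply]
    · rw [Pi.sub_apply, hzero n g hg x hx, smul_zero, smul_zero]
  constructor
  · simp_rw [fun n => heq n f hfR]
    have := tendsto_eLpNorm_of_dominated (μ := volume) h.ne_zero h.ne_top
      (f := fun n x => (χ x * phi p w x) * mollify n f x)
      (g := fun x => (χ x * phi p w x) * f x) (b := fun x => M * ‖χ x * phi p w x‖)
      (fun n => hφp.1.mul (contDiff_mollify hfv.1 n).continuous.aestronglyMeasurable)
      (hφp.1.mul hfm) (hφp.norm.const_mul M)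
      (fun n => ae_of_all _ fun x => by
        rw [norm_mul, mul_comm]
        gcongr
        exact norm_mollify_le hM n x)
      ((ae_tendsto_mollify hfv.1).mono fun x hx => hx.const_mul _)
    refine this.congr fun n => ?_
    congr 1
    funext x
    simp [mul_sub]
  · simp_rw [hfv.gradient_mollify, fun n => heq n v hvR]
    have := tendsto_eLpNorm_smul_mollify h.one_le h.ne_top hφ hGp hM hfv hJ
      (hfG.add hvφ) hvφ hKc
    refine this.congr fun n => ?_
    refine eLpNorm_restrict_eq_of_support_subset fun x hx => ?_
    by_contra hxK
    exact hx (by simp [hzero n v hvR x hxK])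

/-- Every element of `W` is the limit of bounded, compactly supported ones. -/
theorem tendsto_cutoff_sinTrunc (h : IsRegularWeight p w G) {f : E d → ℝ} {v : E d → E d}
    (hf : MemLp f p (weightMeasure w)) (hv : MemLp v p (weightMeasure w)) :
    (∀ n, MemLp (fun x => cutoff d n x • Real.cos (f x / ((n : ℝ) + 1)) • v x +
      sinTrunc n (f x) • gradient (cutoff d n) x) p (weightMeasure w)) ∧
    Tendsto (fun n => eLpNorm ((fun x => cutoff d n x * sinTrunc n (f x)) - f) p (weightMeasure w))
      atTop (𝓝 0) ∧
    Tendsto (fun n => eLpNorm ((fun x => cutoff d n x • Real.cos (f x / ((n : ℝ) + 1)) • v x +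
      sinTrunc n (f x) • gradient (cutoff d n) x) - v) p (weightMeasure w)) atTop (𝓝 0) := by
  obtain ⟨C, hC0, hC⟩ := exists_norm_gradient_cutoff_le d
  have hχ := fun n => cutoff_isTestFunction (d := d) n
  have hbf : ∀ n x, ‖cutoff d n x * sinTrunc n (f x)‖ ≤ ‖f x‖ := by
    intro n x
    rw [norm_mul, Real.norm_of_nonneg (cutoff_nonneg n x)]
    calc _ ≤ 1 * ‖f x‖ := by
          gcongr
          · exact cutoff_le_one n x
          · exact abs_sinTrunc_le n _
      _ = _ := one_mul _
  have hbv : ∀ n x, ‖cutoff d n x • Real.cos (f x / ((n : ℝ) + 1)) • v x +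
      sinTrunc n (f x) • gradient (cutoff d n) x‖ ≤ ‖v x‖ + C * ‖f x‖ := by
    intro n x
    refine (norm_add_le _ _).trans (add_le_add ?_ ?_)
    · rw [norm_smul, norm_smul, Real.norm_of_nonneg (cutoff_nonneg n x)]
      calc _ ≤ 1 * (1 * ‖v x‖) := by
            gcongr
            · exact cutoff_le_one n x
            · exact Real.abs_cos_le_one _
        _ = _ := by rw [one_mul, one_mul]
    · rw [norm_smul, mul_comm]
      gcongr
      · exact hC n x
      · exact abs_sinTrunc_le n _
  have hmf : ∀ n, AEStronglyMeasurable (fun x => cutoff d n x * sinTrunc n (f x))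
      (weightMeasure w) := fun n => (hχ n).1.continuous.aestronglyMeasurable.mul
    ((continuous_sinTrunc n).comp_aestronglyMeasurable hf.1)
  have hmv : ∀ n, AEStronglyMeasurable (fun x => cutoff d n x • Real.cos (f x / ((n : ℝ) + 1)) •
      v x + sinTrunc n (f x) • gradient (cutoff d n) x) (weightMeasure w) := fun n =>
    ((hχ n).1.continuous.aestronglyMeasurable.smul
      (((show Continuous fun t : ℝ => Real.cos (t / ((n : ℝ) + 1)) by
        fun_prop).comp_aestronglyMeasurable hf.1).smul hv.1)).add
    (((continuous_sinTrunc n).comp_aestronglyMeasurable hf.1).smul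
      (continuous_gradient (hχ n).1).aestronglyMeasurable)
  have hb : MemLp (fun x => ‖v x‖ + C * ‖f x‖) p (weightMeasure w) :=
    hv.norm.add (hf.norm.const_mul C)
  have hev : ∀ x : E d, ∀ᶠ n : ℕ in atTop, ‖x‖ < (n : ℝ) + 1 := by
    intro x
    obtain ⟨N, hN⟩ := exists_nat_gt ‖x‖
    filter_upwards [eventually_ge_atTop N] with n hn
    have : (N : ℝ) ≤ n := by exact_mod_cast hn
    linarith
  refine ⟨fun n => hb.mono' (hmv n) (ae_of_all _ (hbv n)),
    tendsto_eLpNorm_of_dominated h.ne_zero h.ne_top hmf hf.1 hf.norm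
      (fun n => ae_of_all _ (hbf n)) (ae_of_all _ fun x => ?_),
    tendsto_eLpNorm_of_dominated h.ne_zero h.ne_top hmv hv.1 hb
      (fun n => ae_of_all _ (hbv n)) (ae_of_all _ fun x => ?_)⟩
  · refine (tendsto_sinTrunc (f x)).congr' ?_
    filter_upwards [hev x] with n hn
    rw [cutoff_eq_one hn, one_mul]
  · have h1 := (tendsto_cos_div (f x)).smul_const (v x)
    rw [one_smul] at h1
    refine h1.congr' ?_
    filter_upwards [hev x] with n hn
    rw [cutoff_eq_one hn, gradient_cutoff_eq_zero hn, smul_zero, add_zero, one_smul]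

/-- Elements of `W` can be approximated by test functions, together with their gradients. -/
theorem exists_isTestFunction (h : IsRegularWeight p w G) {f : E d → ℝ} {v : E d → E d}
    (hf : MemLp f p (weightMeasure w)) (hv : MemLp v p (weightMeasure w))
    (hfv : HasWeakGradient f v) {ε : ℝ≥0∞} (hε : 0 < ε) :
    ∃ η, IsTestFunction η ∧ eLpNorm (η - f) p (weightMeasure w) < ε ∧
      eLpNorm (gradient η - v) p (weightMeasure w) < ε := by
  obtain ⟨hmv, t1, t2⟩ := h.tendsto_cutoff_sinTrunc hf hv
  have hε2 : 0 < ε / 2 := ENNReal.half_pos hε.ne'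
  obtain ⟨n, h1, h2⟩ := ((t1.eventually_lt_const hε2).and (t2.eventually_lt_const hε2)).exists
  have hχ := cutoff_isTestFunction (d := d) n
  have hg : HasWeakGradient (fun x => cutoff d n x * sinTrunc n (f x))
      (fun x => cutoff d n x • Real.cos (f x / ((n : ℝ) + 1)) • v x +
        sinTrunc n (f x) • gradient (cutoff d n) x) :=
    (hfv.comp (hasDerivAt_sinTrunc n) (by fun_prop) fun t => Real.abs_cos_le_one _).smooth_mul hχ.1
  obtain ⟨R, hR⟩ := hχ.2.isBounded.exists_norm_le
  have hts : ∀ x, R < ‖x‖ → x ∉ tsupport (cutoff d n) := fun x hx hx' =>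
    absurd (hR x hx') (not_le.2 hx)
  have hgR : ∀ x, R < ‖x‖ → cutoff d n x * sinTrunc n (f x) = 0 := fun x hx => by
    rw [image_eq_zero_of_notMem_tsupport (hts x hx), zero_mul]
  obtain ⟨t3, t4⟩ := h.tendsto_mollify (M := (n : ℝ) + 1) (R := R) (hmv n) hg (fun x => by
      rw [abs_mul, abs_of_nonneg (cutoff_nonneg n x)]
      exact (mul_le_of_le_one_left (abs_nonneg _) (cutoff_le_one n x)).trans
        (abs_sinTrunc_le_nat n _)) hgR
    (fun x hx => by
      rw [image_eq_zero_of_notMem_tsupport (hts x hx),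
        gradient_eq_zero_of_notMem_tsupport (hts x hx), zero_smul, smul_zero, add_zero])
  obtain ⟨m, h3, h4⟩ := ((t3.eventually_lt_const hε2).and (t4.eventually_lt_const hε2)).exists
  have hη := isTestFunction_mollify hg.1 hgR m
  have ac := absolutelyContinuous w
  refine ⟨_, hη, ?_, ?_⟩
  · rw [← sub_add_sub_cancel _ (fun x => cutoff d n x * sinTrunc n (f x)), ← ENNReal.add_halves ε]
    have hm := hg.1.aestronglyMeasurable.mono_ac ac
    exact (eLpNorm_add_le (hη.1.continuous.aestronglyMeasurable.sub hm) (hm.sub hf.1)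
      h.one_le).trans_lt (ENNReal.add_lt_add h3 h1)
  · rw [← sub_add_sub_cancel _ (fun x => cutoff d n x • Real.cos (f x / ((n : ℝ) + 1)) • v x +
        sinTrunc n (f x) • gradient (cutoff d n) x), ← ENNReal.add_halves ε]
    have hm := hg.2.1.aestronglyMeasurable.mono_ac ac
    exact (eLpNorm_add_le ((continuous_gradient hη.1).aestronglyMeasurable.sub hm) (hm.sub hv.1)
      h.one_le).trans_lt (ENNReal.add_lt_add h4 h2)

end IsRegularWeight

end Density

/-! ### The completion -/

section Completion

theorem IsGradW.unique {d : ℕ} {p : ℝ≥0∞} {w : E d → ℝ} {f : Lp ℝ p (weightMeasure w)}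
    {v v' : Lp (E d) p (weightMeasure w)} (hv : IsGradW p w f v) (hv' : IsGradW p w f v') :
    v = v' :=
  Lp.ext (IsRegularWeight.absolutelyContinuous w (HasWeakGradient.unique hv hv'))

variable {d : ℕ} {p : ℝ≥0∞} [Fact (1 ≤ p)] {w : E d → ℝ} {G : E d → E d}

theorem X.isometry_pair (μ : Measure (E d)) : Isometry (X.pair (d := d) p μ) :=
  AddMonoidHomClass.isometry_of_norm _ fun _ => rfl

theorem H.isometry_pair (μ : Measure (E d)) : Isometry (H.pair (p := p) (μ := μ)) :=
  (X.isometry_pair μ).completion_extension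

theorem H.pair_coe {μ : Measure (E d)} (u : X p μ) : H.pair (u : H p μ) = X.pair p μ u :=
  UniformSpace.Completion.extension_coe (X.isometry_pair μ).uniformContinuous u

namespace IsRegularWeight

theorem isGradW_pair (h : IsRegularWeight p w G) (u : X p (weightMeasure w)) :
    IsGradW p w (X.pair p _ u).fst (X.pair p _ u).snd := by
  have h1 := hasWeakGradient_gradient (u.2.1.differentiable (by simp)) (continuous_gradient u.2.1)
  exact h1.congr_ae (h.absolutelyContinuous'.ae_eq u.2.2.1.coeFn_toLp).symm
    (h.absolutelyContinuous'.ae_eq u.2.2.2.coeFn_toLp).symm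

/-- The graph of the distributional gradient is closed in `L^p(μ) × L^p(μ; ℝ^d)`. -/
theorem isClosed_isGradW (h : IsRegularWeight p w G) :
    IsClosed {P : Pair p (weightMeasure w) | IsGradW p w P.fst P.snd} := by
  refine IsSeqClosed.isClosed fun P Q hP hPQ => ?_
  have hc := (WithLp.prod_continuous_ofLp p (Lp ℝ p (weightMeasure w))
    (Lp (E d) p (weightMeasure w))).tendsto Q
  have h1 := (continuous_fst.tendsto _).comp (hc.comp hPQ)
  have h2 := (continuous_snd.tendsto _).comp (hc.comp hPQ)
  have t1 := (Lp.tendsto_Lp_iff_tendsto_eLpNorm' _ _).1 h1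
  have t2 := (Lp.tendsto_Lp_iff_tendsto_eLpNorm' _ _).1 h2
  refine hasWeakGradient_of_tendsto_eLpNorm hP (h.locallyIntegrable (Lp.memLp _))
    (h.locallyIntegrable (Lp.memLp _)) (fun K hK => ?_) (fun K hK => ?_)
  all_goals obtain ⟨C, hC, hCK⟩ := h.exists_eLpNorm_one_le hK
  · have t := ENNReal.Tendsto.const_mul t1 (Or.inr hC)
    rw [mul_zero] at t
    exact tendsto_of_tendsto_of_tendsto_of_le_of_le tendsto_const_nhds t (fun _ => zero_le)
      fun n => hCK _ (h.aestronglyMeasurable ((Lp.memLp _).1.sub (Lp.memLp _).1))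
  · have t := ENNReal.Tendsto.const_mul t2 (Or.inr hC)
    rw [mul_zero] at t
    exact tendsto_of_tendsto_of_tendsto_of_le_of_le tendsto_const_nhds t (fun _ => zero_le)
      fun n => hCK _ (h.aestronglyMeasurable ((Lp.memLp _).1.sub (Lp.memLp _).1))

theorem isGradW_completion (h : IsRegularWeight p w G) (u : H p (weightMeasure w)) :
    IsGradW p w u.toLp u.grad := by
  refine UniformSpace.Completion.induction_on u
    (h.isClosed_isGradW.preimage (H.isometry_pair _).continuous) fun u => ?_
  rw [H.toLp, H.grad, H.pair_coe]
  exact h.isGradW_pair u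

/-- Elements of `W` are limits of test functions in the norm of `X`. -/
theorem mem_closure_pair (h : IsRegularWeight p w G) {f : Lp ℝ p (weightMeasure w)}
    {v : Lp (E d) p (weightMeasure w)} (hv : IsGradW p w f v) :
    (WithLp.toLp p (f, v) : Pair p (weightMeasure w)) ∈
      closure (X.pair p (weightMeasure w) '' {u | HasCompactSupport u.toFun}) := by
  have := h.isLocallyFiniteMeasure
  have h1 : (f, v) ∈ closure (WithLp.ofLp ''
      (X.pair p (weightMeasure w) '' {u | HasCompactSupport u.toFun})) := by
    refine EMetric.mem_closure_iff.2 fun ε hε => ?_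
    obtain ⟨η, hη, h1, h2⟩ := h.exists_isTestFunction (Lp.memLp f) (Lp.memLp v) hv hε
    have m1 : MemLp η p (weightMeasure w) := hη.1.continuous.memLp_of_hasCompactSupport hη.2
    have m2 : MemLp (gradient η) p (weightMeasure w) :=
      (continuous_gradient hη.1).memLp_of_hasCompactSupport (hasCompactSupport_gradient hη.2)
    refine ⟨_, mem_image_of_mem _ (mem_image_of_mem _
      (show (⟨η, hη.1, m1, m2⟩ : X p (weightMeasure w)) ∈ _ from hη.2)), ?_⟩
    rw [edist_comm, Prod.edist_eq, max_lt_iff]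
    constructor
    · change edist (m1.toLp η) f < ε
      rw [Lp.edist_def, eLpNorm_congr_ae (m1.coeFn_toLp.sub EventuallyEq.rfl)]
      exact h1
    · change edist (m2.toLp (gradient η)) v < ε
      rw [Lp.edist_def, eLpNorm_congr_ae (m2.coeFn_toLp.sub EventuallyEq.rfl)]
      exact h2
  have h2 := image_closure_subset_closure_image
    (WithLp.prod_continuous_toLp p (Lp ℝ p (weightMeasure w)) (Lp (E d) p (weightMeasure w)))
    (mem_image_of_mem _ h1)
  rw [image_image, image_image] at h2
  simpa using h2

/-- The image of the completion contains `W`: it is closed and contains the test functions. -/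
theorem exists_completion (h : IsRegularWeight p w G) {f : Lp ℝ p (weightMeasure w)}
    {v : Lp (E d) p (weightMeasure w)} (hv : IsGradW p w f v) :
    ∃ u : H p (weightMeasure w), u.toLp = f := by
  have hcl : IsClosed (range (H.pair (p := p) (μ := weightMeasure w))) :=
    (H.isometry_pair _).isClosedEmbedding.isClosed_range
  have hsub : X.pair p (weightMeasure w) '' {u | HasCompactSupport u.toFun} ⊆
      range (H.pair (p := p) (μ := weightMeasure w)) := by
    rintro _ ⟨u, -, rfl⟩
    exact ⟨u, H.pair_coe u⟩
  obtain ⟨u, hu⟩ := closure_minimal hsub hcl (h.mem_closure_pair hv)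
  exact ⟨u, congrArg WithLp.fst hu⟩

theorem injective_toLp (h : IsRegularWeight p w G) :
    Function.Injective (H.toLp : H p (weightMeasure w) → Lp ℝ p (weightMeasure w)) := by
  intro u u' huu'
  have h1 := h.isGradW_completion u
  rw [huu'] at h1
  have h2 : u.grad = u'.grad := h1.unique (h.isGradW_completion u')
  refine (H.isometry_pair (weightMeasure w)).injective ?_
  exact WithLp.ofLp_injective p (Prod.ext huu' h2)

theorem dense_hasCompactSupport (h : IsRegularWeight p w G) :
    Dense {u : H p (weightMeasure w) |
      ∃ v : X p (weightMeasure w), HasCompactSupport v.toFun ∧ u = ↑v} := by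
  intro u
  have hi := (H.isometry_pair (p := p) (weightMeasure w)).isUniformInducing.isInducing
  rw [hi.closure_eq_preimage_closure_image]
  refine closure_mono ?_ (h.mem_closure_pair (h.isGradW_completion u))
  rintro _ ⟨v, hv, rfl⟩
  exact ⟨v, ⟨v, hv, rfl⟩, H.pair_coe v⟩

end IsRegularWeight

end Completion

end WeightedSobolev

open WeightedSobolev in
theorem corollary1p2 {d : ℕ} (hd : 1 ≤ d) (p : ℝ≥0∞) [Fact (1 ≤ p)] (hp : p ≠ ⊤)
    (w : E d → ℝ) (hw : LocallyIntegrable w volume) (hw0 : ∀ᵐ x ∂volume, 0 ≤ w x)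
    (G : E d → E d) (hReg : Reg p w) (hDiff : Diff p w G)
    (hLip : p = 1 → LocMemLp G ⊤ volume) :
    -- `H^{1,p}(μ)` is a space of `μ`-classes of functions, in which `C_0^∞` is dense
    Function.Injective (H.toLp : H p (weightMeasure w) → Lp ℝ p (weightMeasure w)) ∧
    Dense {h : H p (weightMeasure w) |
      ∃ u : X p (weightMeasure w), HasCompactSupport u.toFun ∧ h = ↑u} ∧
    -- the three spaces coincide
    range (H.toLp : H p (weightMeasure w) → Lp ℝ p (weightMeasure w)) = V p w G ∧
    V p w G = W p w ∧
    -- and so do their gradients (hence their norms), which are unique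
    (∀ h : H p (weightMeasure w), IsGradV p w G h.toLp h.grad) ∧
    (∀ f v, IsGradV p w G f v ↔ IsGradW p w f v) ∧
    (∀ f v v', IsGradV p w G f v → IsGradV p w G f v' → v = v') := by
  have h : IsRegularWeight p w G := ⟨Fact.out, hp, hw, hw0, hReg, hDiff⟩
  have hVW : ∀ f v, IsGradV p w G f v ↔ IsGradW p w f v := fun f v =>
    ⟨h.isGradW_of_isGradV, h.isGradV_of_isGradW⟩
  refine ⟨h.injective_toLp, h.dense_hasCompactSupport, ?_, ?_,
    fun u => (hVW _ _).2 (h.isGradW_completion u), hVW,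
    fun f v v' hv hv' => ((hVW f v).1 hv).unique ((hVW f v').1 hv')⟩
  · ext f
    constructor
    · rintro ⟨u, rfl⟩
      exact ⟨u.grad, (hVW _ _).2 (h.isGradW_completion u)⟩
    · rintro ⟨v, hv⟩
      exact h.exists_completion ((hVW f v).1 hv)
  · ext f
    exact exists_congr fun v => hVW f v
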